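/- Let $n\ge 1$, $s\in(0,1)$, $\lambda>0$, $\Lambda\in\mathbb R$, $T>0$, $I=(-T,0]$, $I_*=[-T,0]$, and let $\Omega\subset\mathbb R^n$ be a bounded open set (for example a bounded domain with Lipschitz boundary). Let $K:\mathbb R^n\to\mathbb R$ be Lebesgue measurable with $K(y)=K(-y)$ and $$\frac{(1-s)\lambda}{|y|^{n+2s}}\le K(y)\le\frac{(1-s)\Lambda}{|y|^{n+2s}}\qquad(y\ne0),$$ and put $\langle v,w\rangle_K=\iint_{\mathbb R^n\times\mathbb R^n}(v(x)-v(y))(w(x)-w(y))K(x-y)\,dx\,dy$. Let $X_0(\Omega)$ be the space of all Lebesgue measurable $v:\mathbb R^n\to\mathbb R$ with $v|_\Omega\in L^2(\Omega)$, $v=0$ a.e. in $\mathbb R^n\setminus\Omega$ and $$\|v\|_{X_0(\Omega)}=\|v\|_{L^2(\Omega)}+\Big(\iint_{\mathbb R^{2n}\setminus(\Omega^c\times\Omega^c)}\frac{|v(x)-v(y)|^2}{|x-y|^{n+2s}}\,dx\,dy\Big)^{1/2}<\infty ,$$ and let $X_0^*(\Omega)$ be its dual (functions equal a.e. are identified);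 $L^2(\Omega)$ acts on $X_0(\Omega)$ by the $L^2(\Omega)$ pairing. Let $H^1(I;X_0(\Omega))$ be the set of $v\in L^2(I;X_0(\Omega))$ whose weak time derivative $v'$ (as an $X_0^*(\Omega)$-valued function, tested against $C_c^\infty((-T,0))$) exists and lies in $L^2(I;X_0^*(\Omega))$. Let $H^s_T(\mathbb R^n)$ be the set of functions that are Lebesgue measurable on $\mathbb R^n\times I$ and whose slices at every $t\in I_*$ lie in $H^s(\mathbb R^n)$. Let $g\in H^s_T(\mathbb R^n)\cap C(\mathbb R^n\times I_*)\cap L^\infty(\mathbb R^n\times I)$. Let $u$ be a weak solution of the problem $\mathbf{NP}_{\Omega_I}(0,g,g)$, that is, of $$L_Ku+\partial_tu=0\ \text{ in }\Omega\times I,\qquad u=g\ \text{ in }(\mathbb R^n\setminus\Omega)\times I,\qquad u(\cdot,-T)=g(\cdot,-T)\ \text{ in }\mathbb R^n,$$ where $L_K$ is the nonlocal operator with kernel $K$. This means that $u\in H^s_T(\mathbb R^n)$, $u-g\in H^1(I;X_0(\Omega))$, $u$ has a weak time derivative $u'\in L^2(I;X_0^*(\Omega))$ such that for every $\varphi\in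 X_0(\Omega)$ $$\langle u(\cdot,t),\varphi\rangle_K+\langle u'(t),\varphi\rangle=0\qquad\text{for a.e. }t\in I,$$ and $u(\cdot,-T)=g(\cdot,-T)$ a.e., where the value at $-T$ is taken in the sense of the representative of $u-g$ in $C(I_*;L^2(\mathbb R^n))$. Then $u\in L^\infty(\mathbb R^n\times I)$ and $$\|u\|_{L^\infty(\mathbb R^n\times I)}\le 2\,\|g\|_{L^\infty(\mathbb R^n\times I)} .$$ -/

import Mathlib

open MeasureTheory Set Filter Topology
open scoped ENNReal ContDiff

noncomputable section

namespace NonlocalHeat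

/-- The space `ℝⁿ` with its Euclidean norm and Lebesgue measure. -/
abbrev Rn (n : ℕ) : Type := EuclideanSpace ℝ (Fin n)

/-- `K` is a (Lebesgue measurable) symmetric kernel with
`(1 - s) lam / |y|^(n+2s) ≤ K y ≤ (1 - s) Lam / |y|^(n+2s)` for `y ≠ 0`.
For `lam > 0` and `s < 1` it is in particular positive. -/
structure IsKernel (n : ℕ) (s lam Lam : ℝ) (K : Rn n → ℝ) : Prop where
  aemeasurable : AEMeasurable K volume
  symm : ∀ y, K (-y) = K y
  lower : ∀ y, y ≠ 0 → (1 - s) * lam / ‖y‖ ^ ((n : ℝ) + 2 * s) ≤ K y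
  upper : ∀ y, y ≠ 0 → K y ≤ (1 - s) * Lam / ‖y‖ ^ ((n : ℝ) + 2 * s)

/-- The fractional difference quotient `(v x - v y) / |x - y|^((n+2s)/2)`. Its square is
`|v x - v y|² / |x - y|^(n+2s)`, so its `L²` norm over `D ⊆ ℝⁿ × ℝⁿ` is
`(∬_D |v x - v y|² / |x - y|^(n+2s) dx dy)^(1/2)`. -/
def diffQuot {n : ℕ} (s : ℝ) (v : Rn n → ℝ) (p : Rn n × Rn n) : ℝ :=
  (v p.1 - v p.2) / ‖p.1 - p.2‖ ^ (((n : ℝ) + 2 * s) / 2)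

/-- `ℝ²ⁿ_Ω = ℝ²ⁿ \ (Ωᶜ × Ωᶜ)`. -/
def crossDomain {n : ℕ} (Ω : Set (Rn n)) : Set (Rn n × Rn n) := (Ωᶜ ×ˢ Ωᶜ)ᶜ

/-- The fractional Sobolev space `H^s(ℝⁿ)`. -/
def MemHs {n : ℕ} (s : ℝ) (v : Rn n → ℝ) : Prop :=
  MemLp v 2 volume ∧ MemLp (diffQuot s v) 2 volume

theorem diffQuot_add {n : ℕ} (s : ℝ) (v w : Rn n → ℝ) :
    diffQuot s (v + w) = diffQuot s v + diffQuot s w := by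
  funext p
  simp only [diffQuot, Pi.add_apply]
  ring

theorem diffQuot_smul {n : ℕ} (s c : ℝ) (v : Rn n → ℝ) :
    diffQuot s (c • v) = c • diffQuot s v := by
  funext p
  simp only [diffQuot, Pi.smul_apply, smul_eq_mul]
  ring

theorem diffQuot_zero {n : ℕ} (s : ℝ) : diffQuot s (0 : Rn n → ℝ) = 0 := by
  funext p
  simp [diffQuot]

theorem diffQuot_congr {n : ℕ} (s : ℝ) {v w : Rn n → ℝ} (h : v =ᵐ[volume] w)
    (D : Set (Rn n × Rn n)) : diffQuot s v =ᵐ[volume.restrict D] diffQuot s w := by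
  refine ae_restrict_of_ae ?_
  have h1 : ∀ᵐ p : Rn n × Rn n, v p.1 = w p.1 := Measure.quasiMeasurePreserving_fst.ae h
  have h2 : ∀ᵐ p : Rn n × Rn n, v p.2 = w p.2 := Measure.quasiMeasurePreserving_snd.ae h
  filter_upwards [h1, h2] with p hp1 hp2
  simp only [diffQuot, hp1, hp2]

/-- The space `X₀(Ω)` of (a.e. classes of) functions `v` with `v = 0` a.e. in `ℝⁿ \ Ω`,
`v ∈ L²(Ω)`, and `∬_{ℝ²ⁿ_Ω} |v x - v y|² / |x - y|^(n+2s) dx dy < ∞`.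
As `v` vanishes outside `Ω`, `v ∈ L²(Ω)` is the same as `v ∈ L²(ℝⁿ)`. -/
def X0Submodule (n : ℕ) (s : ℝ) (Ω : Set (Rn n)) :
    Submodule ℝ (Lp ℝ 2 (volume : Measure (Rn n))) where
  carrier := {v | (∀ᵐ x ∂volume, x ∉ Ω → v x = 0) ∧
    MemLp (diffQuot s v) 2 (volume.restrict (crossDomain Ω))}
  zero_mem' := by
    have h0 := Lp.coeFn_zero ℝ 2 (volume : Measure (Rn n))
    refine ⟨?_, ?_⟩
    · filter_upwards [h0] with x hx _
      rw [hx]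
      rfl
    · refine (memLp_congr_ae (diffQuot_congr s h0 _)).2 ?_
      rw [diffQuot_zero]
      exact MemLp.zero
  add_mem' := by
    rintro v w ⟨h1, h2⟩ ⟨k1, k2⟩
    refine ⟨?_, ?_⟩
    · filter_upwards [h1, k1, Lp.coeFn_add v w] with x hx kx ha hxΩ
      rw [ha, Pi.add_apply, hx hxΩ, kx hxΩ, add_zero]
    · refine (memLp_congr_ae (diffQuot_congr s (Lp.coeFn_add v w) _)).2 ?_
      rw [diffQuot_add]
      exact h2.add k2
  smul_mem' := by
    rintro c v ⟨h1, h2⟩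
    refine ⟨?_, ?_⟩
    · filter_upwards [h1, Lp.coeFn_smul c v] with x hx ha hxΩ
      rw [ha, Pi.smul_apply, hx hxΩ, smul_zero]
    · refine (memLp_congr_ae (diffQuot_congr s (Lp.coeFn_smul c v) _)).2 ?_
      rw [diffQuot_smul]
      exact h2.const_smul c

/-- The space `X₀(Ω)` as a type of its own, since it does not carry the `L²` norm. -/
def X0 (n : ℕ) (s : ℝ) (Ω : Set (Rn n)) : Type := X0Submodule n s Ω

namespace X0

variable {n : ℕ} {s : ℝ} {Ω : Set (Rn n)}

instance : AddCommGroup (X0 n s Ω) := inferInstanceAs (AddCommGroup (X0Submodule n s Ω))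

instance : Module ℝ (X0 n s Ω) := inferInstanceAs (Module ℝ (X0Submodule n s Ω))

/-- The inclusion of `X₀(Ω)` in `L²`. -/
def toL2 : X0 n s Ω →ₗ[ℝ] Lp ℝ 2 (volume : Measure (Rn n)) := (X0Submodule n s Ω).subtype

instance : CoeFun (X0 n s Ω) (fun _ => Rn n → ℝ) := ⟨fun v => toL2 v⟩

theorem toL2_injective : Function.Injective (toL2 : X0 n s Ω → _) := Subtype.val_injective

theorem ae_eq_zero (v : X0 n s Ω) : ∀ᵐ x ∂volume, x ∉ Ω → v x = 0 := v.2.1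

theorem memLp_diffQuot (v : X0 n s Ω) :
    MemLp (diffQuot s v) 2 (volume.restrict (crossDomain Ω)) := v.2.2

/-- The linear map sending `v ∈ X₀(Ω)` to its fractional difference quotient in `L²(ℝ²ⁿ_Ω)`. -/
def diffQuotLp : X0 n s Ω →ₗ[ℝ] Lp ℝ 2 ((volume : Measure (Rn n × Rn n)).restrict
    (crossDomain Ω)) where
  toFun v := v.memLp_diffQuot.toLp
  map_add' v w := by
    rw [← MemLp.toLp_add]
    refine MemLp.toLp_congr _ _ ?_
    rw [← diffQuot_add, map_add]
    exact diffQuot_congr s (Lp.coeFn_add _ _) _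
  map_smul' c v := by
    rw [RingHom.id_apply, ← MemLp.toLp_const_smul]
    refine MemLp.toLp_congr _ _ ?_
    rw [← diffQuot_smul, map_smul]
    exact diffQuot_congr s (Lp.coeFn_smul _ _) _

/-- The norm of `X₀(Ω)`,
`‖v‖ = ‖v‖_{L²(Ω)} + (∬_{ℝ²ⁿ_Ω} |v x - v y|² / |x - y|^(n+2s) dx dy)^(1/2)`. -/
instance : NormedAddCommGroup (X0 n s Ω) :=
  AddGroupNorm.toNormedAddCommGroup
    { toFun := fun v => ‖toL2 v‖ + ‖diffQuotLp v‖
      map_zero' := by simp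
      add_le' := fun v w => by
        rw [map_add, map_add]
        linarith [norm_add_le (toL2 v) (toL2 w), norm_add_le (diffQuotLp v) (diffQuotLp w)]
      neg' := fun v => by simp
      eq_zero_of_map_eq_zero' := fun v hv => by
        have h1 := norm_nonneg (toL2 v)
        have h2 := norm_nonneg (diffQuotLp v)
        have h3 : ‖toL2 v‖ = 0 := by linarith
        exact toL2_injective ((norm_eq_zero.1 h3).trans (map_zero toL2).symm) }

theorem norm_def (v : X0 n s Ω) : ‖v‖ = ‖toL2 v‖ + ‖diffQuotLp v‖ := rfl

instance : NormedSpace ℝ (X0 n s Ω) where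
  norm_smul_le c v := by
    rw [norm_def, norm_def, map_smul, map_smul, norm_smul, norm_smul, mul_add]

end X0

/-- The dual space `X₀*(Ω)` of bounded linear functionals on `X₀(Ω)`, with the operator norm. -/
abbrev X0Dual (n : ℕ) (s : ℝ) (Ω : Set (Rn n)) : Type := StrongDual ℝ (X0 n s Ω)

/-- The time interval `I = (-T, 0]`. -/
abbrev timeI (T : ℝ) : Set ℝ := Ioc (-T) 0

/-- The time slice `u(·, t)` of a function `u(x, t)`. -/
def slice {n : ℕ} (u : Rn n × ℝ → ℝ) (t : ℝ) : Rn n → ℝ := fun x => u (x, t)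

/-- Lebesgue measure on `ℝⁿ_I = ℝⁿ × I`. -/
def volRnI (n : ℕ) (T : ℝ) : Measure (Rn n × ℝ) := volume.restrict (univ ×ˢ timeI T)

/-- `H^s_T(ℝⁿ)`: functions that are Lebesgue measurable on `ℝⁿ × I` and whose slices lie in
`H^s(ℝⁿ)` for all `t ∈ [-T, 0]`. -/
def MemHsT {n : ℕ} (s T : ℝ) (u : Rn n × ℝ → ℝ) : Prop :=
  AEMeasurable u (volRnI n T) ∧ ∀ t ∈ Icc (-T) 0, MemHs s (slice u t)

/-- `b` is the weak derivative of `a` on the interval `I`, both being integrable: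
`∫_I ψ' a dt = - ∫_I ψ b dt` for all test functions `ψ`. -/
def HasWeakDeriv (T : ℝ) (a b : ℝ → ℝ) : Prop :=
  IntegrableOn a (timeI T) ∧ IntegrableOn b (timeI T) ∧
    ∀ ψ : ℝ → ℝ, ContDiff ℝ ∞ ψ → HasCompactSupport ψ → tsupport ψ ⊆ Ioo (-T) 0 →
      ∫ t in timeI T, deriv ψ t * a t = -∫ t in timeI T, ψ t * b t

/-- `u'` is the weak time derivative of `u` as a function with values in `X₀*(Ω)`, where
`L²(Ω) ⊆ X₀*(Ω)` through the `L²(Ω)` pairing. -/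
def HasWeakTimeDeriv {n : ℕ} {s : ℝ} {Ω : Set (Rn n)} (T : ℝ) (u : Rn n × ℝ → ℝ)
    (u' : ℝ → X0Dual n s Ω) : Prop :=
  ∀ φ : X0 n s Ω, HasWeakDeriv T (fun t => ∫ x in Ω, slice u t x * φ x) (fun t => u' t φ)

/-- `v ∈ H¹(I; X₀(Ω))`, that is, `v ∈ L²(I; X₀(Ω))` and `v' ∈ L²(I; X₀*(Ω))`. -/
def MemH1X0 {n : ℕ} (s T : ℝ) (Ω : Set (Rn n)) (v : Rn n × ℝ → ℝ) : Prop :=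
  (∃ V : ℝ → X0 n s Ω, MemLp V 2 (volume.restrict (timeI T)) ∧
      ∀ᵐ t ∂(volume.restrict (timeI T)), X0.toL2 (V t) =ᵐ[volume] slice v t) ∧
    ∃ v' : ℝ → X0Dual n s Ω, MemLp v' 2 (volume.restrict (timeI T)) ∧ HasWeakTimeDeriv T v v'

/-- `u ∈ H¹(I; X_g(Ω))`, that is, `u ∈ H^s_T(ℝⁿ)` and `u - g ∈ H¹(I; X₀(Ω))`. -/
def MemH1Xg {n : ℕ} (s T : ℝ) (Ω : Set (Rn n)) (g u : Rn n × ℝ → ℝ) : Prop :=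
  MemHsT s T u ∧ MemH1X0 s T Ω (u - g)

/-- The bilinear form
`⟨u, v⟩_K = ∬_{ℝⁿ × ℝⁿ} (u x - u y) (v x - v y) K(x - y) dx dy`. -/
def kForm {n : ℕ} (K : Rn n → ℝ) (u v : Rn n → ℝ) : ℝ :=
  ∫ p : Rn n × Rn n, (u p.1 - u p.2) * (v p.1 - v p.2) * K (p.1 - p.2)

/-- The initial condition `u(-T) = h`. It is understood through the representative of `u - g`
in `C([-T, 0]; L²)` (which agrees with `u - g` for a.e. `t`): its value at `-T` is
`u(-T) - g(-T)`, where `u(-T) = h` a.e. -/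
def HasInitialValue {n : ℕ} (T : ℝ) (g : Rn n × ℝ → ℝ) (h : Rn n → ℝ)
    (u : Rn n × ℝ → ℝ) : Prop :=
  slice u (-T) =ᵐ[volume] h ∧
    ∃ V : ℝ → Lp ℝ 2 (volume : Measure (Rn n)), ContinuousOn V (Icc (-T) 0) ∧
      (∀ᵐ t ∂(volume.restrict (timeI T)), V t =ᵐ[volume] slice (u - g) t) ∧
      V (-T) =ᵐ[volume] slice (u - g) (-T)

/-- `u ∈ H¹(I; X_g(Ω))` is a weak solution of `NP_{Ω_I}(f, g, h)`:
`L_K u + ∂ₜ u = f` in `Ω × I`, `u = g` in `(ℝⁿ \ Ω) × I`, `u(·, -T) = h`. -/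
structure IsWeakSolution {n : ℕ} {s : ℝ} {Ω : Set (Rn n)} (T : ℝ) (K : Rn n → ℝ)
    (f : ℝ → X0Dual n s Ω) (g : Rn n × ℝ → ℝ) (h : Rn n → ℝ) (u : Rn n × ℝ → ℝ) : Prop where
  mem : MemH1Xg s T Ω g u
  equation : ∃ u' : ℝ → X0Dual n s Ω, MemLp u' 2 (volume.restrict (timeI T)) ∧
    HasWeakTimeDeriv T u u' ∧
    ∀ φ : X0 n s Ω, ∀ᵐ t ∂(volume.restrict (timeI T)),
      kForm K (slice u t) φ + (u' t - f t) φ = 0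
  initial : HasInitialValue T g h u

end NonlocalHeat

end

/-! The estimate is a weak maximum principle, and it even holds with constant 1. Let M be the sup
norm of g. By the symmetry u ↦ -u it suffices that u ≤ M a.e. Test the equation at time t with W(t)
= (u(t) - M)⁺, which lies in X₀(Ω) because u = g off Ω. The kernel form pairs nonnegatively with it,
so formally the energy E(t) = ½‖W(t)‖² in L² is nonincreasing. It starts from 0, because E ≤ ½‖u -
g‖² and u - g has an L²-continuous representative vanishing at -T.

To make this rigorous without a chain rule for E, the test function is frozen at time t. Convexity
of r ↦ ½((r - M)⁺)² gives E(t) - E(τ) ≤ ∫_τ^t ⟨u'(σ), W(t)⟩ dσ for τ ≤ t. Since ⟨u'(t), W(t)⟩ ≤ 0,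
the integrand is at most ‖W(t)‖ ‖u'(σ) - u'(t)‖ (`truncEnergy_slice_sub_le`), and coercivity bounds
‖W(t)‖ by a square integrable function of t (`norm_posPart_le`). Translation is continuous in L², so
with t - τ = h these increments are o(h) after integration in t, which forces E = 0 a.e.
(`ae_eq_zero_of_sub_le`).

The null sets of times on which the equation or the integrated form of u' may fail depend on the
test function; separability of X₀(Ω) merges them into one. -/

noncomputable section

namespace NonlocalHeat

/-! ### Weak derivatives on an interval -/

/-- A smooth function supported in a compact subset of `(a, b)` with zero integral has a smooth
primitive supported in `(a, b)`. -/
theorem exists_primitive_of_integral_eq_zero {a b : ℝ} {η : ℝ → ℝ} {K : Set ℝ}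
    (hη : ContDiff ℝ ∞ η) (hK : IsCompact K) (hKne : K.Nonempty) (hKab : K ⊆ Ioo a b)
    (hsupp : ∀ x, x ∉ K → η x = 0) (hint : ∫ x, η x = 0) :
    ∃ ψ : ℝ → ℝ, ContDiff ℝ ∞ ψ ∧ HasCompactSupport ψ ∧ tsupport ψ ⊆ Ioo a b ∧
      deriv ψ = η := by
  -- The primitive based at the least point α vanishes to the left of α, and to the right of the
  -- greatest point β it equals the total integral, which is zero.
  obtain ⟨α, hα, hα'⟩ := hK.exists_isLeast hKne
  obtain ⟨β, hβ, hβ'⟩ := hK.exists_isGreatest hKne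
  have hηc : Continuous η := hη.continuous
  have hderiv : ∀ x, HasDerivAt (fun x => ∫ t in α..x, η t) (η x) x := fun x =>
    intervalIntegral.integral_hasDerivAt_right (hηc.intervalIntegrable _ _)
      (hηc.stronglyMeasurableAtFilter _ _) hηc.continuousAt
  have hderiv' : deriv (fun x => ∫ t in α..x, η t) = η := funext fun x => (hderiv x).deriv
  have hlow : ∀ x, x < α → η x = 0 := fun x hx => hsupp x fun h => (hα' h).not_gt hx
  have hup : ∀ x, β < x → η x = 0 := fun x hx => hsupp x fun h => (hβ' h).not_gt hx
  have hsub : Function.support (fun x => ∫ t in α..x, η t) ⊆ Icc α β := by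
    intro x hx
    by_contra hmem
    apply hx
    rcases lt_or_ge x α with h | h
    · show ∫ t in α..x, η t = 0
      rw [intervalIntegral.integral_symm, intervalIntegral.integral_of_le h.le,
        integral_Ioc_eq_integral_Ioo, setIntegral_eq_zero_of_forall_eq_zero, neg_zero]
      exact fun t ht => hlow t ht.2
    · have h' : β < x := by
        by_contra h'
        exact hmem ⟨h, not_lt.1 h'⟩
      show ∫ t in α..x, η t = 0
      rw [intervalIntegral.integral_of_le h, ← integral_Icc_eq_integral_Ioc,
        setIntegral_eq_integral_of_forall_compl_eq_zero, hint]
      intro t ht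
      rcases lt_or_ge t α with h1 | h1
      · exact hlow t h1
      · exact hup t (h'.trans (by
          by_contra h2
          exact ht ⟨h1, not_lt.1 h2⟩))
  have hts : tsupport (fun x => ∫ t in α..x, η t) ⊆ Icc α β :=
    closure_minimal hsub isClosed_Icc
  refine ⟨fun x => ∫ t in α..x, η t, ?_, ?_, ?_, hderiv'⟩
  · rw [contDiff_infty_iff_deriv, hderiv']
    exact ⟨fun x => (hderiv x).differentiableAt, hη⟩
  · exact HasCompactSupport.of_support_subset_isCompact isCompact_Icc hsub
  · exact hts.trans fun x hx => ⟨(hKab hα).1.trans_le hx.1, hx.2.trans_lt (hKab hβ).2⟩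

/-- **Du Bois-Reymond lemma**: an integrable function with zero weak derivative is constant. -/
theorem ae_eq_const_of_integral_deriv_mul_eq_zero {a b : ℝ} (hab : a < b) {c : ℝ → ℝ}
    (hc : IntegrableOn c (Ioc a b))
    (h : ∀ ψ : ℝ → ℝ, ContDiff ℝ ∞ ψ → HasCompactSupport ψ → tsupport ψ ⊆ Ioo a b →
      ∫ t in Ioc a b, deriv ψ t * c t = 0) :
    ∃ k, ∀ᵐ t ∂(volume.restrict (Ioc a b)), c t = k := by
  -- Outer radius (b - a) / 4 about the midpoint keeps the closed support inside the open interval.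
  let f : ContDiffBump ((a + b) / 2) := ⟨(b - a) / 8, (b - a) / 4, by linarith, by linarith⟩
  set ρ : ℝ → ℝ := f.normed volume with hρ
  have hρ1 : ∫ x, ρ x = 1 := f.integral_normed
  have hρc : ContDiff ℝ ∞ ρ := f.contDiff_normed
  have hρs : tsupport ρ ⊆ Ioo a b := by
    rw [hρ, f.tsupport_normed_eq, Real.closedBall_eq_Icc]
    intro x hx
    have h1 : f.rOut = (b - a) / 4 := rfl
    rw [h1] at hx
    exact ⟨by linarith [hx.1], by linarith [hx.2]⟩
  have hρcs : HasCompactSupport ρ := f.hasCompactSupport_normed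
  have hρne : (tsupport ρ).Nonempty := by
    by_contra hne
    rw [not_nonempty_iff_eq_empty, tsupport_eq_empty_iff] at hne
    simp [hne] at hρ1
  have hmul : ∀ φ : ℝ → ℝ, ContDiff ℝ ∞ φ → HasCompactSupport φ →
      IntegrableOn (fun x => φ x * c x) (Ioc a b) := by
    intro φ h1 h2
    obtain ⟨C, hC⟩ := h2.exists_bound_of_continuous h1.continuous
    exact hc.bdd_mul h1.continuous.aestronglyMeasurable (Eventually.of_forall hC)
  refine ⟨∫ t in Ioc a b, ρ t * c t, ?_⟩
  set k := ∫ t in Ioc a b, ρ t * c t with hk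
  have key := isOpen_Ioo.ae_eq_zero_of_integral_contDiff_smul_eq_zero (μ := volume)
    (U := Ioo a b) (f := fun t => c t - k)
    (((hc.mono_set Ioo_subset_Ioc_self).sub (by simp)).locallyIntegrableOn) ?_
  · rw [← restrict_Ioo_eq_restrict_Ioc, ae_restrict_iff' measurableSet_Ioo]
    filter_upwards [key] with t ht hmem
    exact sub_eq_zero.1 (ht hmem)
  · intro φ hφ hφc hφs
    have hφi : Integrable φ := hφ.continuous.integrable_of_hasCompactSupport hφc
    have hρi : Integrable ρ := hρc.continuous.integrable_of_hasCompactSupport hρcs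
    -- Subtracting (∫ φ) ρ makes the mean zero, so an arbitrary test function becomes a derivative
    -- up to a multiple of ρ; that multiple produces the constant k.
    obtain ⟨ψ, h1, h2, h3, h4⟩ := exists_primitive_of_integral_eq_zero (a := a) (b := b)
      (η := fun x => φ x - (∫ y, φ y) * ρ x) (K := tsupport φ ∪ tsupport ρ)
      (hφ.sub (contDiff_const.mul hρc)) (hφc.isCompact.union hρcs.isCompact) (hρne.inr)
      (union_subset hφs hρs)
      (fun x hx => by
        rw [image_eq_zero_of_notMem_tsupport fun h => hx (Or.inl h),
          image_eq_zero_of_notMem_tsupport fun h => hx (Or.inr h)]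
        simp)
      (by rw [integral_sub hφi (hρi.const_mul _), integral_const_mul, hρ1]; ring)
    have h5 := h ψ h1 h2 h3
    rw [h4] at h5
    have h6 : ∫ t in Ioc a b, (φ t - (∫ y, φ y) * ρ t) * c t
        = (∫ t in Ioc a b, φ t * c t) - (∫ y, φ y) * k := by
      rw [hk, ← integral_const_mul, ← integral_sub (hmul φ hφ hφc)
        ((hmul ρ hρc hρcs).const_mul _)]
      exact integral_congr_ae (Eventually.of_forall fun t => by ring)
    rw [h6] at h5
    have hz : ∀ t, t ∉ Ioc a b → φ t = 0 := fun t ht =>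
      image_eq_zero_of_notMem_tsupport fun h => ht (Ioo_subset_Ioc_self (hφs h))
    have h7 : ∫ t, φ t • (c t - k) = ∫ t in Ioc a b, φ t * (c t - k) := by
      rw [setIntegral_eq_integral_of_forall_compl_eq_zero]
      · rfl
      · intro t ht; rw [hz t ht, zero_mul]
    have h8 : ∫ t in Ioc a b, φ t = ∫ t, φ t :=
      setIntegral_eq_integral_of_forall_compl_eq_zero hz
    rw [h7]
    simp_rw [mul_sub]
    rw [integral_sub (hmul φ hφ hφc) (hφi.integrableOn.mul_const k), integral_mul_const, h8]
    exact h5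

/-- The primitive of b is absolutely continuous, and integration by parts shows that it has weak
derivative b. Its difference from a then has zero weak derivative, so du Bois-Reymond applies. -/
theorem HasWeakDeriv.exists_ae_eq {T : ℝ} (hT : 0 < T) {a b : ℝ → ℝ} (h : HasWeakDeriv T a b) :
    ∃ k, ∀ᵐ t ∂(volume.restrict (timeI T)), a t = k + ∫ σ in (-T)..t, b σ := by
  obtain ⟨ha, hb, hw⟩ := h
  have hbi : IntervalIntegrable b volume (-T) 0 :=
    (intervalIntegrable_iff_integrableOn_Ioc_of_le (by linarith)).2 hb
  have hac := hbi.absolutelyContinuousOnInterval_intervalIntegral (c := -T) (by simp)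
  have hBc : ContinuousOn (fun t => ∫ σ in (-T)..t, b σ) (Icc (-T) 0) := by
    have := hac.continuousOn
    rwa [uIcc_of_le (by linarith)] at this
  have hBi : IntegrableOn (fun t => ∫ σ in (-T)..t, b σ) (timeI T) :=
    (hBc.integrableOn_Icc).mono_set Ioc_subset_Icc_self
  obtain ⟨k, hk⟩ := ae_eq_const_of_integral_deriv_mul_eq_zero (a := -T) (b := 0) (by linarith)
    (c := fun t => a t - ∫ σ in (-T)..t, b σ) (ha.sub hBi) (by
      intro ψ h1 h2 h3
      have hψ' : Continuous (deriv ψ) := h1.continuous_deriv (by simp)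
      obtain ⟨C, hC⟩ := h2.deriv.exists_bound_of_continuous hψ'
      have hi : ∀ f : ℝ → ℝ, IntegrableOn f (timeI T) →
          IntegrableOn (fun t => deriv ψ t * f t) (timeI T) := fun f hf =>
        hf.bdd_mul hψ'.aestronglyMeasurable (Eventually.of_forall hC)
      have hz : ∀ t, t ∉ Ioo (-T) 0 → ψ t = 0 := fun t ht =>
        image_eq_zero_of_notMem_tsupport fun h => ht (h3 h)
      have hibp := AbsolutelyContinuousOnInterval.integral_mul_deriv_eq_deriv_mul hac
        ((h1.of_le (by simp)).contDiffOn (s := uIcc (-T) 0)).absolutelyContinuousOnInterval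
      rw [hz 0 (by simp), hz (-T) (by simp), intervalIntegral.integral_same,
        intervalIntegral.integral_of_le (by linarith),
        intervalIntegral.integral_of_le (by linarith), intervalIntegral.integral_of_le (by linarith)] at hibp
      simp_rw [mul_sub]
      rw [integral_sub (hi a ha) (hi _ hBi), hw ψ h1 h2 h3]
      have e1 : ∫ t in timeI T, deriv ψ t * ∫ σ in (-T)..t, b σ
          = ∫ t in Ioc (-T) 0, (∫ σ in (-T)..t, b σ) * deriv ψ t := by
        simp_rw [mul_comm (deriv ψ _)]
      have e2 : ∫ t in Ioc (-T) 0, deriv (fun x => ∫ σ in (-T)..x, b σ) t * ψ t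
          = ∫ t in timeI T, ψ t * b t := by
        refine integral_congr_ae ?_
        refine (ae_restrict_iff' measurableSet_Ioc).2 ?_
        filter_upwards [hbi.ae_hasDerivAt_integral] with t ht hmem
        rw [(ht (by rw [uIcc_of_le (by linarith)]; exact Ioc_subset_Icc_self hmem) (-T)
          (by simp)).deriv, mul_comm]
      rw [e1, hibp, e2]
      ring)
  refine ⟨k, ?_⟩
  filter_upwards [hk] with t ht
  linarith

/-! ### Translations in L² and a vanishing criterion -/

theorem integral_norm_sq_eq_eLpNorm_sq {α Y : Type*} [MeasurableSpace α] {μ : Measure α}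
    [NormedAddCommGroup Y] {f : α → Y} (hf : MemLp f 2 μ) :
    ∫ x, ‖f x‖ ^ 2 ∂μ = (eLpNorm f 2 μ).toReal ^ 2 := by
  have h0 : 0 ≤ ∫ x, ‖f x‖ ^ 2 ∂μ := integral_nonneg fun _ => by positivity
  rw [hf.eLpNorm_eq_integral_rpow_norm two_ne_zero ENNReal.ofNat_ne_top]
  simp only [ENNReal.toReal_ofNat, Real.rpow_two]
  rw [ENNReal.toReal_ofReal (by positivity), ← Real.rpow_natCast, ← Real.rpow_mul h0]
  norm_num

theorem memLp_comp_sub_sub {Y : Type*} [NormedAddCommGroup Y] {U : ℝ → Y}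
    (hU : MemLp U 2 volume) (y : ℝ) : MemLp (fun t => U (t - y) - U t) 2 volume :=
  (hU.comp_measurePreserving (measurePreserving_sub_right volume y)).sub hU

/-- Translation is continuous in `L²(ℝ)`. -/
theorem tendsto_integral_norm_comp_sub_sub_sq {Y : Type*} [NormedAddCommGroup Y] {U : ℝ → Y}
    (hU : MemLp U 2 volume) :
    Tendsto (fun y => ∫ t, ‖U (t - y) - U t‖ ^ 2) (𝓝 0) (𝓝 0) := by
  let g : ℝ → C(ℝ, ℝ) := fun y => ⟨fun t => t - y, by fun_prop⟩
  have hg : Continuous g := ContinuousMap.continuous_of_continuous_uncurry _ (by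
    show Continuous fun p : ℝ × ℝ => p.2 - p.1
    fun_prop)
  have hgm : ∀ y, MeasurePreserving (g y) volume volume := fun y =>
    measurePreserving_sub_right volume y
  have hc := (continuous_const (y := hU.toLp U)).compMeasurePreservingLp hg hgm
    (p := 2) (by simp)
  have h0 : Lp.compMeasurePreserving (g 0) (hgm 0) (hU.toLp U) = hU.toLp U := by
    refine Lp.ext ?_
    filter_upwards [Lp.coeFn_compMeasurePreserving (hU.toLp U) (hgm 0)] with t ht
    rw [ht]
    simp [g]
  have h1 : Tendsto (fun y => ‖Lp.compMeasurePreserving (g y) (hgm y) (hU.toLp U) - hU.toLp U‖ ^ 2)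
      (𝓝 0) (𝓝 (‖Lp.compMeasurePreserving (g 0) (hgm 0) (hU.toLp U) - hU.toLp U‖ ^ 2)) :=
    ((hc.sub (continuous_const (y := hU.toLp U))).norm.pow 2).tendsto 0
  rw [h0, sub_self, norm_zero, zero_pow two_ne_zero] at h1
  refine h1.congr fun y => ?_
  rw [integral_norm_sq_eq_eLpNorm_sq (memLp_comp_sub_sub hU y), Lp.norm_def]
  congr 2
  refine eLpNorm_congr_ae ?_
  filter_upwards [Lp.coeFn_sub (Lp.compMeasurePreserving (g y) (hgm y) (hU.toLp U)) (hU.toLp U),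
    Lp.coeFn_compMeasurePreserving (hU.toLp U) (hgm y), hU.coeFn_toLp,
    (hgm y).quasiMeasurePreserving.ae hU.coeFn_toLp] with t h1 h2 h3 h4
  rw [h1, Pi.sub_apply, h2, h3, Function.comp_apply, h4]
  rfl

/-- Fubini: integrate in t first, where each shift y contributes at most m, then over y in an
interval of length h. -/
theorem integrable_integral_norm_comp_sub_sub_sq {Y : Type*} [NormedAddCommGroup Y] {U : ℝ → Y}
    (hU : MemLp U 2 volume) {h m : ℝ} (hh : 0 < h)
    (hm' : ∀ y ∈ Ioc 0 h, ∫ t, ‖U (t - y) - U t‖ ^ 2 ≤ m) :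
    Integrable (fun t => ∫ y in Ioc 0 h, ‖U (t - y) - U t‖ ^ 2) ∧
      ∫ t, ∫ y in Ioc 0 h, ‖U (t - y) - U t‖ ^ 2 ≤ h * m := by
  have hm : AEStronglyMeasurable (fun p : ℝ × ℝ => ‖U (p.1 - p.2) - U p.1‖ ^ 2)
      ((volume : Measure ℝ).prod (volume.restrict (Ioc 0 h))) := by
    have h1 : AEStronglyMeasurable (fun p : ℝ × ℝ => U (p.1 - p.2) - U p.1)
        ((volume : Measure ℝ).prod volume) :=
      (hU.1.comp_quasiMeasurePreserving (quasiMeasurePreserving_sub volume volume)).sub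
        (hU.1.comp_quasiMeasurePreserving Measure.quasiMeasurePreserving_fst)
    have h2 := (h1.norm.pow 2).restrict (s := univ ×ˢ Ioc 0 h)
    rwa [← Measure.prod_restrict, Measure.restrict_univ] at h2
  have hsq : ∀ y, Integrable (fun t => ‖U (t - y) - U t‖ ^ 2) := fun y =>
    (memLp_comp_sub_sub hU y).integrable_norm_pow two_ne_zero
  have hnn : ∀ y, ∫ t, ‖‖U (t - y) - U t‖ ^ 2‖ = ∫ t, ‖U (t - y) - U t‖ ^ 2 := fun y => by
    simp
  have hi2 : Integrable (fun y => ∫ t, ‖U (t - y) - U t‖ ^ 2) (volume.restrict (Ioc 0 h)) := by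
    refine Integrable.mono' (g := fun _ => m) (integrable_const m) hm.prod_swap.integral_prod_right' ?_
    refine (ae_restrict_iff' measurableSet_Ioc).2 (Eventually.of_forall fun y hy => ?_)
    rw [Real.norm_of_nonneg (integral_nonneg fun _ => by positivity)]
    exact hm' y hy
  have hint : Integrable (fun p : ℝ × ℝ => ‖U (p.1 - p.2) - U p.1‖ ^ 2)
      ((volume : Measure ℝ).prod (volume.restrict (Ioc 0 h))) := by
    rw [integrable_prod_iff' hm]
    exact ⟨Eventually.of_forall hsq, by simpa using hi2⟩
  refine ⟨hint.integral_prod_left, ?_⟩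
  rw [integral_integral_swap hint]
  calc ∫ y in Ioc 0 h, ∫ t, ‖U (t - y) - U t‖ ^ 2 ≤ ∫ y in Ioc 0 h, m :=
        setIntegral_mono_on hi2 (integrable_const m) measurableSet_Ioc hm'
    _ = h * m := by simp [hh.le]

/-- A nonnegative function on `(a, b]` vanishes if its increments are controlled by the `L²`
modulus of continuity of some `U ∈ L²`, to first order with a square integrable factor. -/
theorem ae_eq_zero_of_sub_le {Y : Type*} [NormedAddCommGroup Y] {a b : ℝ} {E B : ℝ → ℝ}
    {U : ℝ → Y} (hE0 : ∀ t, 0 ≤ E t) (hEi : Integrable E) (hEs : ∀ t, t ∉ Ioc a b → E t = 0)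
    (hB : MemLp B 2 volume) (hB0 : ∀ t, 0 ≤ B t) (hU : MemLp U 2 volume)
    (hinc : ∀ h, 0 < h → ∀ᵐ t, E t - E (t - h) ≤ B t * ∫ y in Ioc 0 h, ‖U (t - y) - U t‖) :
    E =ᵐ[volume] 0 := by
  -- Without a weight, E(t) - E(t - h) integrates to zero and says nothing. The factor exp(-t)
  -- leaves a gain (1 - exp(-h)) ∫ f, of first order in h.
  set f : ℝ → ℝ := fun t => E t * Real.exp (-t) with hf
  set C := Real.exp (-a) with hC
  have hCpos : 0 < C := Real.exp_pos _
  have hf0 : ∀ t, 0 ≤ f t := fun t => mul_nonneg (hE0 t) (Real.exp_pos _).le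
  have hfC : ∀ t, f t ≤ C * E t := fun t => by
    by_cases ht : t ∈ Ioc a b
    · rw [mul_comm]
      have : Real.exp (-t) ≤ C := Real.exp_le_exp.2 (by linarith [ht.1])
      exact mul_le_mul_of_nonneg_left this (hE0 t)
    · simp [hf, hEs t ht]
  have hfi : Integrable f := by
    refine (hEi.const_mul C).mono' (hEi.1.mul (by fun_prop)) (Eventually.of_forall fun t => ?_)
    rw [Real.norm_of_nonneg (hf0 t)]
    exact hfC t
  have hBsq : Integrable (fun t => B t ^ 2) := hB.integrable_sq
  set β := ∫ t, B t ^ 2 with hβ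
  have hβ0 : 0 ≤ β := integral_nonneg fun _ => by positivity
  have hmain : ∀ δ, 0 < δ → ∫ t, f t ≤ C * (β + 1) * δ := by
    intro δ hδ
    obtain ⟨r, hr, hball⟩ := Metric.eventually_nhds_iff.1
      ((tendsto_integral_norm_comp_sub_sub_sq hU).eventually_le_const
        (show (0 : ℝ) < δ ^ 2 by positivity))
    -- h < r makes all shifts by y ≤ h cost at most δ²; h ≤ 1 is for 1 - exp(-h) ≥ h / 2.
    obtain ⟨h, hh0, hh1, hhr⟩ : ∃ h : ℝ, 0 < h ∧ h ≤ 1 ∧ h < r :=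
      ⟨min 1 (r / 2), by positivity, min_le_left _ _, (min_le_right _ _).trans_lt (by linarith)⟩
    obtain ⟨hDi, hDle⟩ := integrable_integral_norm_comp_sub_sub_sq hU hh0 (m := δ ^ 2)
      (fun y hy => hball (by
        rw [Real.dist_eq, sub_zero, abs_of_pos hy.1]; exact hy.2.trans_lt hhr))
    have hpt : ∀ᵐ t, f t - Real.exp (-h) * f (t - h)
        ≤ C * (h * δ / 2 * B t ^ 2
          + (2 * δ)⁻¹ * ∫ y in Ioc 0 h, ‖U (t - y) - U t‖ ^ 2) := by
      filter_upwards [hinc h hh0] with t ht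
      have hMem : MemLp (fun y => U (t - y) - U t) 2 (volume.restrict (Ioc 0 h)) :=
        ((hU.comp_measurePreserving (Measure.measurePreserving_sub_left volume t)).restrict
          _).sub (memLp_const _)
      have hi1 : Integrable (fun y => ‖U (t - y) - U t‖) (volume.restrict (Ioc 0 h)) :=
        (hMem.integrable (by norm_num)).norm
      have hi2 : Integrable (fun y => ‖U (t - y) - U t‖ ^ 2) (volume.restrict (Ioc 0 h)) :=
        hMem.integrable_norm_pow two_ne_zero
      -- Young's inequality with weight δ: after integration in t both terms are of size h δ, one
      -- order smaller than the gain h / 2 as δ → 0.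
      have hYoung : B t * ∫ y in Ioc 0 h, ‖U (t - y) - U t‖
          ≤ h * δ / 2 * B t ^ 2 + (2 * δ)⁻¹ * ∫ y in Ioc 0 h, ‖U (t - y) - U t‖ ^ 2 := by
        have h1 : h * δ / 2 * B t ^ 2 = ∫ y in Ioc 0 h, δ / 2 * B t ^ 2 := by
          simp [hh0.le]; ring
        rw [h1, ← integral_const_mul, ← integral_const_mul,
          ← integral_add (integrable_const _) (hi2.const_mul _)]
        refine integral_mono (hi1.const_mul _)
          ((integrable_const _).add (hi2.const_mul _)) fun y => ?_
        show B t * ‖U (t - y) - U t‖ ≤ δ / 2 * B t ^ 2 + (2 * δ)⁻¹ * ‖U (t - y) - U t‖ ^ 2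
        rw [← sub_nonneg]
        have : δ / 2 * B t ^ 2 + (2 * δ)⁻¹ * ‖U (t - y) - U t‖ ^ 2 - B t * ‖U (t - y) - U t‖
            = (2 * δ)⁻¹ * (δ * B t - ‖U (t - y) - U t‖) ^ 2 := by
          field_simp
          ring
        rw [this]
        positivity
      have hnn : 0 ≤ B t * ∫ y in Ioc 0 h, ‖U (t - y) - U t‖ :=
        mul_nonneg (hB0 t) (integral_nonneg fun _ => norm_nonneg _)
      have he : Real.exp (-h) * f (t - h) = E (t - h) * Real.exp (-t) := by
        rw [hf]
        show Real.exp (-h) * (E (t - h) * Real.exp (-(t - h))) = _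
        rw [mul_left_comm, ← Real.exp_add]
        congr 2
        ring
      refine le_trans ?_ (mul_le_mul_of_nonneg_left hYoung hCpos.le)
      rw [he]
      by_cases htm : t ∈ Ioc a b
      · calc E t * Real.exp (-t) - E (t - h) * Real.exp (-t)
            = Real.exp (-t) * (E t - E (t - h)) := by ring
          _ ≤ Real.exp (-t) * (B t * ∫ y in Ioc 0 h, ‖U (t - y) - U t‖) :=
            mul_le_mul_of_nonneg_left ht (Real.exp_pos _).le
          _ ≤ C * (B t * ∫ y in Ioc 0 h, ‖U (t - y) - U t‖) := by
            refine mul_le_mul_of_nonneg_right ?_ hnn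
            exact Real.exp_le_exp.2 (by linarith [htm.1])
      -- Off (a, b] the left side is nonpositive, so the drop of E to zero after b does no harm.
      · have : f t = 0 := by simp [hf, hEs t htm]
        rw [this]
        have := mul_nonneg (hE0 (t - h)) (Real.exp_pos (-t)).le
        have := mul_nonneg hCpos.le hnn
        linarith
    have hfi' : Integrable (fun t => f (t - h)) := hfi.comp_sub_right h
    have hI := integral_mono_ae (hfi.sub (hfi'.const_mul _))
      (((hBsq.const_mul _).add (hDi.const_mul _)).const_mul C) hpt
    simp only [Pi.sub_apply, Pi.add_apply] at hI
    rw [integral_sub hfi (hfi'.const_mul _), integral_const_mul, integral_const_mul,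
      integral_add (hBsq.const_mul _) (hDi.const_mul _), integral_const_mul, integral_const_mul,
      integral_sub_right_eq_self f h, ← hβ] at hI
    have hexp : h / 2 ≤ 1 - Real.exp (-h) := by
      have h1 : Real.exp (-h) ≤ (1 + h)⁻¹ := by
        rw [Real.exp_neg]
        exact inv_anti₀ (by linarith) (by linarith [Real.add_one_le_exp h])
      have h2 : (1 + h)⁻¹ ≤ 1 - h / 2 := by
        rw [inv_le_iff_one_le_mul₀ (by linarith)]
        nlinarith
      linarith
    have hint0 : 0 ≤ ∫ t, f t := integral_nonneg hf0
    have h3 : h / 2 * ∫ t, f t ≤ h / 2 * (C * (β + 1) * δ) := by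
      calc h / 2 * ∫ t, f t ≤ (1 - Real.exp (-h)) * ∫ t, f t :=
            mul_le_mul_of_nonneg_right hexp hint0
        _ ≤ C * (h * δ / 2 * β + (2 * δ)⁻¹ * (h * δ ^ 2)) := by
            refine le_trans (by linarith) (hI.trans (mul_le_mul_of_nonneg_left ?_ hCpos.le))
            gcongr
        _ = h / 2 * (C * (β + 1) * δ) := by
            field_simp
    exact le_of_mul_le_mul_left h3 (by linarith)
  have hle : ∫ t, f t ≤ 0 := by
    refine le_of_forall_pos_le_add fun ε hε => ?_
    rw [zero_add]
    refine (hmain (ε / (C * (β + 1))) (by positivity)).trans (le_of_eq ?_)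
    field_simp
  have h0 := (integral_eq_zero_iff_of_nonneg hf0 hfi).1 (le_antisymm hle (integral_nonneg hf0))
  filter_upwards [h0] with t ht
  simpa [hf, Real.exp_ne_zero] using ht
/-- Version of `ae_eq_zero_of_sub_le` for functions given on `(a, b]`, with increments controlled
between the points of a set of full measure, and with zero initial value. -/
theorem ae_eq_zero_of_sub_le_of_ae {Y : Type*} [NormedAddCommGroup Y] {a b : ℝ} {e β : ℝ → ℝ}
    {f : ℝ → Y} {Good : ℝ → Prop} (he0 : ∀ t, 0 ≤ e t) (hei : IntegrableOn e (Ioc a b))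
    (hβ0 : ∀ t, 0 ≤ β t) (hβ : MemLp β 2 (volume.restrict (Ioc a b)))
    (hf : MemLp f 2 (volume.restrict (Ioc a b)))
    (hgoodI : ∀ᵐ t ∂(volume.restrict (Ioc a b)), Good t)
    (hinit : ∀ ε, 0 < ε → ∃ r > a, ∀ τ ∈ Ioc a r, τ ∈ Ioc a b → Good τ → e τ ≤ ε)
    (hinc : ∀ t ∈ Ioc a b, Good t → ∀ τ ∈ Ioc a b, Good τ → τ ≤ t →
      e t - e τ ≤ β t * ∫ σ in Ioc τ t, ‖f σ - f t‖) :
    ∀ᵐ t ∂(volume.restrict (Ioc a b)), e t = 0 := by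
  have hgood : ∀ᵐ t, t ∈ Ioc a b → Good t := (ae_restrict_iff' measurableSet_Ioc).1 hgoodI
  set E := (Ioc a b).indicator e with hE
  set B := (Ioc a b).indicator β with hB
  set U := (Ioc a b).indicator f with hU
  have hUm : MemLp U 2 volume := (memLp_indicator_iff_restrict measurableSet_Ioc).2 hf
  have hBm : MemLp B 2 volume := (memLp_indicator_iff_restrict measurableSet_Ioc).2 hβ
  have hE0 : ∀ t, 0 ≤ E t := fun t => indicator_nonneg (fun t _ => he0 t) t
  have hUint : ∀ t c d : ℝ, IntegrableOn (fun σ => ‖U σ - U t‖) (Ioc c d) := fun t c d =>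
    (((hUm.restrict (Ioc c d)).integrable (by norm_num)).sub (integrable_const _)).norm
  have hstep : ∀ t ∈ Ioc a b, Good t → ∀ τ ∈ Ioc a b, Good τ → τ ≤ t →
      e t - e τ ≤ β t * ∫ σ in Ioc τ t, ‖U σ - U t‖ := by
    intro t ht hgt τ hτ hgτ hτt
    have h1 : ∫ σ in Ioc τ t, ‖U σ - U t‖ = ∫ σ in Ioc τ t, ‖f σ - f t‖ := by
      refine setIntegral_congr_fun measurableSet_Ioc fun σ hσ => ?_
      have hσI : σ ∈ Ioc a b := ⟨hτ.1.trans hσ.1, hσ.2.trans ht.2⟩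
      simp only [hU, indicator_of_mem hσI, indicator_of_mem ht]
    rw [h1]
    exact hinc t ht hgt τ hτ hgτ hτt
  have hstart : ∀ t ∈ Ioc a b, Good t → e t ≤ β t * ∫ σ in Ioc a t, ‖U σ - U t‖ := by
    intro t ht hgt
    refine le_of_forall_pos_le_add fun ε hε => ?_
    obtain ⟨r, hr, hr'⟩ := hinit ε hε
    -- An interval of positive length cannot consist of bad times only, so some good τ lies close
    -- enough to a.
    obtain ⟨τ, hτmem, hτg⟩ : ∃ τ ∈ Ioc a (min r t), τ ∈ Ioc a b → Good τ := by
      by_contra! hcon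
      have h0 : volume (Ioc a (min r t)) = 0 :=
        by
        refine measure_mono_null (fun τ hτ => ?_) (ae_iff.1 hgood)
        exact fun hτg => (hcon τ hτ).2 (hτg (hcon τ hτ).1)
      rw [Real.volume_Ioc, ENNReal.ofReal_eq_zero] at h0
      have := lt_min hr ht.1
      linarith
    have hτt : τ ≤ t := hτmem.2.trans (min_le_right _ _)
    have hτI : τ ∈ Ioc a b := ⟨hτmem.1, hτt.trans ht.2⟩
    have h1 := hstep t ht hgt τ hτI (hτg hτI) hτt
    have h2 : e τ ≤ ε := hr' τ ⟨hτmem.1, hτmem.2.trans (min_le_left _ _)⟩ hτI (hτg hτI)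
    have h3 : ∫ σ in Ioc τ t, ‖U σ - U t‖ ≤ ∫ σ in Ioc a t, ‖U σ - U t‖ :=
      setIntegral_mono_set (hUint t _ _) (Eventually.of_forall fun _ => norm_nonneg _)
        (Ioc_subset_Ioc_left hτmem.1.le).eventuallyLE
    have h4 := mul_le_mul_of_nonneg_left h3 (hβ0 t)
    linarith
  have hzero := ae_eq_zero_of_sub_le hE0 ((integrable_indicator_iff measurableSet_Ioc).2 hei)
    (fun t ht => indicator_of_notMem ht _) hBm (fun t => indicator_nonneg (fun t _ => hβ0 t) t)
    hUm (by
      intro h hh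
      have hgood2 := (measurePreserving_sub_right volume h).quasiMeasurePreserving.ae hgood
      filter_upwards [hgood, hgood2] with t hg1 hg2
      have hcv : ∫ y in Ioc 0 h, ‖U (t - y) - U t‖ = ∫ σ in Ioc (t - h) t, ‖U σ - U t‖ := by
        rw [← intervalIntegral.integral_of_le hh.le,
          intervalIntegral.integral_comp_sub_left (fun σ => ‖U σ - U t‖) t, sub_zero,
          intervalIntegral.integral_of_le (by linarith)]
      rw [hcv]
      by_cases ht : t ∈ Ioc a b
      · have e1 : E t = e t := indicator_of_mem ht _
        have e2 : B t = β t := indicator_of_mem ht _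
        rw [e1, e2]
        by_cases hτ : t - h ∈ Ioc a b
        · have e3 : E (t - h) = e (t - h) := indicator_of_mem hτ _
          rw [e3]
          exact hstep t ht (hg1 ht) _ hτ (hg2 hτ) (by linarith)
        -- The shifted time falls before a, where the extension by zero is admissible because of the
        -- zero initial value (`hstart`).
        · have e3 : E (t - h) = 0 := indicator_of_notMem hτ _
          have hle : t - h ≤ a := by
            by_contra hcon
            exact hτ ⟨not_le.1 hcon, by linarith [ht.2]⟩
          rw [e3, sub_zero]
          refine (hstart t ht (hg1 ht)).trans (mul_le_mul_of_nonneg_left ?_ (hβ0 t))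
          exact setIntegral_mono_set (hUint t _ _) (Eventually.of_forall fun _ => norm_nonneg _)
            (Ioc_subset_Ioc_left hle).eventuallyLE
      · have e1 : E t = 0 := indicator_of_notMem ht _
        have e2 : B t = 0 := indicator_of_notMem ht _
        rw [e1, e2, zero_mul]
        linarith [hE0 (t - h)])
  filter_upwards [ae_restrict_of_ae hzero, ae_restrict_mem measurableSet_Ioc] with t h1 ht
  rwa [hE, indicator_of_mem ht] at h1

/-! ### The space X₀(Ω) and the kernel form -/

section

namespace X0
variable {n : ℕ} {s : ℝ} {Ω : Set (Rn n)}

theorem norm_toL2_le (v : X0 n s Ω) : ‖toL2 v‖ ≤ ‖v‖ := by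
  rw [norm_def]; linarith [norm_nonneg (diffQuotLp v)]

theorem norm_diffQuotLp_le (v : X0 n s Ω) : ‖diffQuotLp v‖ ≤ ‖v‖ := by
  rw [norm_def]; linarith [norm_nonneg (toL2 v)]

/-- The inclusion of `X₀(Ω)` in `L²` as a continuous linear map. -/
def toL2CLM : X0 n s Ω →L[ℝ] Lp ℝ 2 (volume : Measure (Rn n)) :=
  toL2.mkContinuous 1 fun v => by rw [one_mul]; exact norm_toL2_le v

/-- The difference quotient as a continuous linear map. -/
def diffQuotCLM : X0 n s Ω →L[ℝ] Lp ℝ 2 ((volume : Measure (Rn n × Rn n)).restrict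
    (crossDomain Ω)) :=
  diffQuotLp.mkContinuous 1 fun v => by rw [one_mul]; exact norm_diffQuotLp_le v

theorem toL2CLM_apply (v : X0 n s Ω) : toL2CLM v = toL2 v := rfl

theorem diffQuotCLM_apply (v : X0 n s Ω) : diffQuotCLM v = diffQuotLp v := rfl

/-- The pair (v, difference quotient of v) embeds X₀(Ω) into a product of two separable L² spaces.
Factor 2 compares the sum of the two norms with their maximum. Separability later yields one null
set of times for all test functions. -/
instance : SecondCountableTopology (X0 n s Ω) := by
  have : Fact ((2 : ℝ≥0∞) ≠ ⊤) := ⟨ENNReal.ofNat_ne_top⟩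
  have : MeasurableSpace.CountablyGenerated (Rn n × Rn n) :=
    countablyGenerated_of_standardBorel
  have h : AntilipschitzWith 2 (toL2CLM.prod diffQuotCLM : X0 n s Ω →L[ℝ] _) :=
    AddMonoidHomClass.antilipschitz_of_bound _ fun v => by
      rw [norm_def, ContinuousLinearMap.prod_apply, Prod.norm_def]
      have h1 := le_max_left ‖toL2CLM v‖ ‖diffQuotCLM v‖
      have h2 := le_max_right ‖toL2CLM v‖ ‖diffQuotCLM v‖
      rw [toL2CLM_apply, diffQuotCLM_apply] at *
      push_cast
      linarith
  have h1 : SecondCountableTopology (Lp ℝ 2 (volume : Measure (Rn n))) := inferInstance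
  have h2 : SecondCountableTopology (Lp ℝ 2 ((volume : Measure (Rn n × Rn n)).restrict
    (crossDomain Ω))) := inferInstance
  exact (h.isUniformInducing
    (ContinuousLinearMap.uniformContinuous _)).isInducing.secondCountableTopology

theorem diffQuot_eq_zero (v : X0 n s Ω) :
    ∀ᵐ p : Rn n × Rn n, p ∉ crossDomain Ω → diffQuot s v p = 0 := by
  have h1 : ∀ᵐ p : Rn n × Rn n, p.1 ∉ Ω → v p.1 = 0 :=
    Measure.quasiMeasurePreserving_fst.ae v.ae_eq_zero
  have h2 : ∀ᵐ p : Rn n × Rn n, p.2 ∉ Ω → v p.2 = 0 :=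
    Measure.quasiMeasurePreserving_snd.ae v.ae_eq_zero
  filter_upwards [h1, h2] with p hp1 hp2 hp
  simp only [crossDomain, mem_compl_iff, not_not, mem_prod] at hp
  simp [diffQuot, hp1 hp.1, hp2 hp.2]

theorem coeFn_diffQuotLp (v : X0 n s Ω) :
    diffQuotLp v =ᵐ[volume.restrict (crossDomain Ω)] diffQuot s v :=
  v.memLp_diffQuot.coeFn_toLp

theorem norm_diffQuotLp_sq (v : X0 n s Ω) :
    ‖diffQuotLp v‖ ^ 2 = ∫ p in crossDomain Ω, diffQuot s v p ^ 2 := by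
  have h := integral_norm_sq_eq_eLpNorm_sq v.memLp_diffQuot
  have h2 : ‖diffQuotLp v‖ = (eLpNorm (diffQuot s v) 2
      (volume.restrict (crossDomain Ω))).toReal := Lp.norm_toLp _ v.memLp_diffQuot
  rw [h2, ← h]
  simp

end X0

variable {n : ℕ} {s lam Lam : ℝ} {K : Rn n → ℝ} {Ω : Set (Rn n)}

theorem aestronglyMeasurable_sub_prod {v : Rn n → ℝ} (hv : AEStronglyMeasurable v volume) :
    AEStronglyMeasurable (fun p : Rn n × Rn n => v p.1 - v p.2) volume :=
  (hv.comp_quasiMeasurePreserving Measure.quasiMeasurePreserving_fst).sub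
    (hv.comp_quasiMeasurePreserving Measure.quasiMeasurePreserving_snd)

theorem aestronglyMeasurable_diffQuot {v : Rn n → ℝ} (hv : AEStronglyMeasurable v volume) :
    AEStronglyMeasurable (diffQuot s v) volume := by
  have h : Measurable fun p : Rn n × Rn n => ‖p.1 - p.2‖ ^ (((n : ℝ) + 2 * s) / 2) := by
    fun_prop
  exact ((aestronglyMeasurable_sub_prod hv).aemeasurable.div
    h.aemeasurable).aestronglyMeasurable

theorem IsKernel.aestronglyMeasurable_comp_sub (hK : IsKernel n s lam Lam K) :
    AEStronglyMeasurable (fun p : Rn n × Rn n => K (p.1 - p.2)) volume :=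
  hK.aemeasurable.aestronglyMeasurable.comp_quasiMeasurePreserving
    (quasiMeasurePreserving_sub volume volume)

theorem IsKernel.nonneg (hK : IsKernel n s lam Lam K) (hs1 : s < 1) (hlam : 0 < lam)
    {y : Rn n} (hy : y ≠ 0) : 0 ≤ K y :=
  le_trans (div_nonneg (mul_nonneg (by linarith) hlam.le) (by positivity)) (hK.lower y hy)

theorem rpow_half_mul_self {x : ℝ} (hx : 0 < x) (a : ℝ) : x ^ (a / 2) * x ^ (a / 2) = x ^ a := by
  rw [← Real.rpow_add hx]
  congr 1
  ring

/-- The weight `|x - y|^((n+2s)/2) K(x - y)` times the increment of `v`, which represents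
`kForm K v` against difference quotients. -/
def kernelQuot (s : ℝ) (K v : Rn n → ℝ) (p : Rn n × Rn n) : ℝ :=
  (v p.1 - v p.2) * K (p.1 - p.2) * ‖p.1 - p.2‖ ^ (((n : ℝ) + 2 * s) / 2)

theorem kernelQuot_mul_diffQuot (v w : Rn n → ℝ) (p : Rn n × Rn n) :
    kernelQuot s K v p * diffQuot s w p
      = (v p.1 - v p.2) * (w p.1 - w p.2) * K (p.1 - p.2) := by
  rcases eq_or_ne p.1 p.2 with h | h
  · simp [kernelQuot, h]
  · have h1 : 0 < ‖p.1 - p.2‖ := norm_pos_iff.2 (sub_ne_zero.2 h)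
    have h2 : ‖p.1 - p.2‖ ^ (((n : ℝ) + 2 * s) / 2) ≠ 0 := (Real.rpow_pos_of_pos h1 _).ne'
    simp only [kernelQuot, diffQuot]
    field_simp

/-- The upper kernel bound leaves one half power of |x - y|^(n+2s) in the denominator, that is, at
most (1 - s) Lam times the difference quotient. -/
theorem memLp_kernelQuot (hK : IsKernel n s lam Lam K) (hs1 : s < 1) (hlam : 0 < lam)
    {v : Rn n → ℝ} (hv : MemHs s v) : MemLp (kernelQuot s K v) 2 volume := by
  refine hv.2.of_le_mul (c := (1 - s) * Lam) ?_ (Eventually.of_forall fun p => ?_)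
  · have h : Measurable fun p : Rn n × Rn n => ‖p.1 - p.2‖ ^ (((n : ℝ) + 2 * s) / 2) := by
      fun_prop
    exact ((aestronglyMeasurable_sub_prod hv.1.1).mul
      hK.aestronglyMeasurable_comp_sub).mul h.aestronglyMeasurable
  · rcases eq_or_ne p.1 p.2 with h | h
    · simp [kernelQuot, diffQuot, h]
    · have h0 : p.1 - p.2 ≠ 0 := sub_ne_zero.2 h
      have h1 : 0 < ‖p.1 - p.2‖ := norm_pos_iff.2 h0
      have h2 := Real.rpow_pos_of_pos h1 (((n : ℝ) + 2 * s) / 2)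
      have h3 := hK.upper _ h0
      have h4 := hK.nonneg hs1 hlam h0
      rw [← rpow_half_mul_self h1, le_div_iff₀ (by positivity)] at h3
      simp only [kernelQuot, diffQuot, norm_mul, norm_div, Real.norm_eq_abs, abs_of_pos h2,
        abs_of_nonneg h4]
      rw [← mul_div_assoc, le_div_iff₀ h2]
      nlinarith [mul_le_mul_of_nonneg_left h3 (abs_nonneg (v p.1 - v p.2))]

/-- The form is the L² pairing of `kernelQuot` with the difference quotient of φ, which vanishes
a.e. off `crossDomain Ω`. Continuity in φ permits density arguments. -/
theorem exists_dual_eq_kForm (hK : IsKernel n s lam Lam K) (hs1 : s < 1) (hlam : 0 < lam)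
    {v : Rn n → ℝ} (hv : MemHs s v) :
    ∃ L : X0Dual n s Ω, ∀ φ : X0 n s Ω, L φ = kForm K v φ := by
  have hm := (memLp_kernelQuot hK hs1 hlam hv).restrict (crossDomain Ω)
  refine ⟨(innerSL ℝ (hm.toLp _)).comp X0.diffQuotCLM, fun φ => ?_⟩
  rw [ContinuousLinearMap.comp_apply, X0.diffQuotCLM_apply, innerSL_apply_apply, L2.inner_def,
    kForm]
  have h1 : ∫ p in crossDomain Ω, kernelQuot s K v p * diffQuot s φ p
      = ∫ p, kernelQuot s K v p * diffQuot s φ p := by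
    refine setIntegral_eq_integral_of_ae_compl_eq_zero ?_
    filter_upwards [φ.diffQuot_eq_zero] with p hp hmem
    rw [hp hmem, mul_zero]
  simp_rw [← kernelQuot_mul_diffQuot (s := s)]
  rw [← h1]
  refine integral_congr_ae ?_
  filter_upwards [hm.coeFn_toLp, φ.coeFn_diffQuotLp] with p h2 h3
  rw [h2, h3]
  simp [mul_comm]

theorem exists_dual_eq_setIntegral (hΩ : MeasurableSet Ω) {f : Rn n → ℝ}
    (hf : MemLp f 2 volume) :
    ∃ L : X0Dual n s Ω, ∀ φ : X0 n s Ω, L φ = ∫ x in Ω, f x * φ x := by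
  have hm := hf.indicator hΩ
  refine ⟨(innerSL ℝ (hm.toLp _)).comp X0.toL2CLM, fun φ => ?_⟩
  rw [ContinuousLinearMap.comp_apply, X0.toL2CLM_apply, innerSL_apply_apply, L2.inner_def,
    ← integral_indicator hΩ]
  refine integral_congr_ae ?_
  filter_upwards [hm.coeFn_toLp] with x hx
  rw [hx]
  by_cases h : x ∈ Ω <;> simp [h, mul_comm]

/-! ### Truncations as test functions -/

theorem abs_max_sub_max_le (a b M : ℝ) : |max (a - M) 0 - max (b - M) 0| ≤ |a - b| := by
  have := abs_max_sub_max_le_abs (a - M) (b - M) 0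
  simpa using this

theorem memLp_posPart {v : Rn n → ℝ} (hv : MemLp v 2 volume) {M : ℝ} (hM : 0 ≤ M) :
    MemLp (fun x => max (v x - M) 0) 2 volume := by
  refine hv.mono ((hv.1.sub aestronglyMeasurable_const).sup aestronglyMeasurable_const)
    (Eventually.of_forall fun x => ?_)
  rw [Real.norm_eq_abs, Real.norm_eq_abs, abs_of_nonneg (le_max_right _ _)]
  exact max_le (by linarith [le_abs_self (v x)]) (abs_nonneg _)

theorem memLp_diffQuot_posPart {v : Rn n → ℝ} (hv : MemHs s v) (M : ℝ) :
    MemLp (diffQuot s fun x => max (v x - M) 0) 2 volume := by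
  refine hv.2.mono (aestronglyMeasurable_diffQuot
    ((hv.1.1.sub aestronglyMeasurable_const).sup aestronglyMeasurable_const))
    (Eventually.of_forall fun p => ?_)
  simp only [diffQuot, norm_div]
  gcongr
  exact abs_max_sub_max_le _ _ _

theorem exists_X0_posPart {v : Rn n → ℝ} (hv : MemHs s v) {M : ℝ} (hM : 0 ≤ M)
    (hΩ : ∀ᵐ x, x ∉ Ω → v x ≤ M) :
    ∃ W : X0 n s Ω, W =ᵐ[volume] fun x => max (v x - M) 0 := by
  have h1 := memLp_posPart hv.1 hM
  have h2 := memLp_diffQuot_posPart hv M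
  refine ⟨⟨h1.toLp _, ?_, ?_⟩, h1.coeFn_toLp⟩
  · filter_upwards [h1.coeFn_toLp, hΩ] with x hx hx' hxΩ
    rw [hx]
    exact max_eq_right (by linarith [hx' hxΩ])
  · exact (memLp_congr_ae (diffQuot_congr s h1.coeFn_toLp _)).2 (h2.restrict _)

theorem kForm_congr_right {v w w' : Rn n → ℝ} (h : w =ᵐ[volume] w') :
    kForm K v w = kForm K v w' := by
  refine integral_congr_ae ?_
  have h1 : ∀ᵐ p : Rn n × Rn n, w p.1 = w' p.1 := Measure.quasiMeasurePreserving_fst.ae h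
  have h2 : ∀ᵐ p : Rn n × Rn n, w p.2 = w' p.2 := Measure.quasiMeasurePreserving_snd.ae h
  filter_upwards [h1, h2] with p hp1 hp2
  simp only [hp1, hp2]

/-- The truncation is nondecreasing and 1-Lipschitz; this is the pointwise source of coercivity. -/
theorem sq_max_sub_max_le (a b M : ℝ) :
    (max (a - M) 0 - max (b - M) 0) ^ 2 ≤ (a - b) * (max (a - M) 0 - max (b - M) 0) := by
  rcases le_total (a - M) 0 with h1 | h1 <;> rcases le_total (b - M) 0 with h2 | h2 <;>
    simp only [max_eq_left, max_eq_right, h1, h2] <;> nlinarith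

/-- Coercivity of the form on truncations. -/
theorem le_kForm_posPart (hK : IsKernel n s lam Lam K) (hs1 : s < 1) (hlam : 0 < lam)
    {v : Rn n → ℝ} (hv : MemHs s v) {M : ℝ} {W : X0 n s Ω}
    (hW : W =ᵐ[volume] fun x => max (v x - M) 0) :
    (1 - s) * lam * ‖X0.diffQuotLp W‖ ^ 2 ≤ kForm K v W := by
  set w : Rn n → ℝ := fun x => max (v x - M) 0 with hw
  have h2 : MemLp (diffQuot s w) 2 volume := memLp_diffQuot_posPart hv M
  have hc : 0 < (1 - s) * lam := mul_pos (by linarith) hlam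
  rw [kForm_congr_right hW, X0.norm_diffQuotLp_sq, kForm]
  have e1 : ∫ p in crossDomain Ω, diffQuot s W p ^ 2 = ∫ p in crossDomain Ω, diffQuot s w p ^ 2 :=
    integral_congr_ae (by
      filter_upwards [diffQuot_congr s hW (crossDomain Ω)] with p hp
      rw [hp])
  have e2 : ∫ p in crossDomain Ω, diffQuot s w p ^ 2 ≤ ∫ p, diffQuot s w p ^ 2 :=
    setIntegral_le_integral h2.integrable_sq (Eventually.of_forall fun p => sq_nonneg _)
  rw [e1]
  refine (mul_le_mul_of_nonneg_left e2 hc.le).trans ?_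
  rw [← integral_const_mul]
  refine integral_mono (h2.integrable_sq.const_mul _) ?_ fun p => ?_
  · refine ((memLp_kernelQuot hK hs1 hlam hv).integrable_mul h2).congr
      (Eventually.of_forall fun p => kernelQuot_mul_diffQuot v w p)
  · show (1 - s) * lam * diffQuot s w p ^ 2 ≤ (v p.1 - v p.2) * (w p.1 - w p.2) * K (p.1 - p.2)
    rcases eq_or_ne p.1 p.2 with h | h
    · simp [diffQuot, h]
    · have h0 : p.1 - p.2 ≠ 0 := sub_ne_zero.2 h
      have h1 : 0 < ‖p.1 - p.2‖ := norm_pos_iff.2 h0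
      have h3 := hK.lower _ h0
      have h4 := hK.nonneg hs1 hlam h0
      have h5 : (1 - s) * lam * diffQuot s w p ^ 2
          = (w p.1 - w p.2) ^ 2 * ((1 - s) * lam / ‖p.1 - p.2‖ ^ ((n : ℝ) + 2 * s)) := by
        rw [diffQuot, div_pow, sq (‖p.1 - p.2‖ ^ _), rpow_half_mul_self h1]
        ring
      rw [h5]
      exact mul_le_mul (sq_max_sub_max_le _ _ _) h3 (by positivity)
        ((sq_nonneg _).trans (sq_max_sub_max_le _ _ _))

end

/-! ### The energy argument and the maximum principle -/

section

variable {n : ℕ} {s lam Lam T M : ℝ} {K : Rn n → ℝ} {Ω : Set (Rn n)} {u : Rn n × ℝ → ℝ}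
  {u' : ℝ → X0Dual n s Ω}

theorem volRnI_eq_prod (n : ℕ) (T : ℝ) :
    volRnI n T = (volume : Measure (Rn n)).prod (volume.restrict (timeI T)) := by
  rw [volRnI, Measure.volume_eq_prod, ← Measure.prod_restrict, Measure.restrict_univ]

theorem ae_ae_slice_of_ae {p : Rn n × ℝ → Prop} (h : ∀ᵐ z ∂(volRnI n T), p z) :
    ∀ᵐ t ∂(volume.restrict (timeI T)), ∀ᵐ x : Rn n, p (x, t) := by
  rw [volRnI_eq_prod, ← Measure.prod_swap] at h
  exact Measure.ae_ae_of_ae_prod (ae_of_ae_map measurable_swap.aemeasurable h)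

/-- Passing from slices to the product needs a measurable set, so u is replaced by a measurable
representative f, which agrees with it on almost every slice. -/
theorem ae_le_of_ae_ae_slice (hum : AEMeasurable u (volRnI n T))
    (h : ∀ᵐ t ∂(volume.restrict (timeI T)), ∀ᵐ x, slice u t x ≤ M) :
    ∀ᵐ z ∂(volRnI n T), u z ≤ M := by
  obtain ⟨f, hfm, hf⟩ := hum
  have h1 := ae_ae_slice_of_ae hf
  have h2 : ∀ᵐ z ∂(volRnI n T), f z ≤ M := by
    rw [volRnI_eq_prod, ← Measure.prod_swap]
    have hms : MeasurableSet {z : Rn n × ℝ | f z ≤ M} :=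
      measurableSet_le hfm measurable_const
    refine (ae_map_iff measurable_swap.aemeasurable hms).2 ?_
    refine (Measure.ae_prod_iff_ae_ae (measurable_swap hms)).2 ?_
    filter_upwards [h, h1] with t ht ht1
    filter_upwards [ht, ht1] with x hx hx1
    show f (x, t) ≤ M
    rw [← hx1]
    exact hx
  filter_upwards [h2, hf] with z hz hz1
  rw [hz1]
  exact hz

/-- The equation holds at almost every time for all test functions simultaneously. -/
theorem ae_forall_kForm_add_eq_zero (hK : IsKernel n s lam Lam K) (hs1 : s < 1)
    (hlam : 0 < lam) (hu : ∀ t ∈ Icc (-T) 0, MemHs s (slice u t))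
    (heq : ∀ φ : X0 n s Ω, ∀ᵐ t ∂(volume.restrict (timeI T)),
      kForm K (slice u t) φ + u' t φ = 0) :
    ∀ᵐ t ∂(volume.restrict (timeI T)), ∀ φ : X0 n s Ω, kForm K (slice u t) φ + u' t φ = 0 := by
  obtain ⟨D, hDc, hDd⟩ := TopologicalSpace.exists_countable_dense (X0 n s Ω)
  have h := (ae_ball_iff hDc).2 fun φ (_ : φ ∈ D) => heq φ
  filter_upwards [h, ae_restrict_mem measurableSet_Ioc] with t ht hmem
  obtain ⟨L, hL⟩ := exists_dual_eq_kForm (Ω := Ω) hK hs1 hlam (hu t (Ioc_subset_Icc_self hmem))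
  have h1 : (fun φ => (L + u' t) φ) = fun _ => 0 :=
    -- For fixed t both terms are continuous in φ, so the identity extends from the countable dense
    -- set.
    Continuous.ext_on hDd (L + u' t).continuous continuous_const fun φ hφ => by
      rw [add_apply, hL]
      exact ht φ hφ
  intro φ
  rw [← hL]
  exact congrFun h1 φ

/-- Outside a null set of times, `u(t) - u(τ)` is the integral of the weak time derivative. -/
theorem exists_ae_setIntegral_sub_eq (hT : 0 < T) (hΩ : MeasurableSet Ω)
    (hu : ∀ t ∈ Icc (-T) 0, MemHs s (slice u t))
    (hu' : MemLp u' 2 (volume.restrict (timeI T))) (hw : HasWeakTimeDeriv T u u') :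
    ∃ P : ℝ → Prop, (∀ᵐ t ∂(volume.restrict (timeI T)), P t) ∧
      ∀ t ∈ timeI T, ∀ τ ∈ timeI T, P t → P τ → ∀ φ : X0 n s Ω,
        (∫ x in Ω, slice u t x * φ x) - (∫ x in Ω, slice u τ x * φ x)
          = ∫ σ in τ..t, u' σ φ := by
  obtain ⟨D, hDc, hDd⟩ := TopologicalSpace.exists_countable_dense (X0 n s Ω)
  choose k hk using fun φ : X0 n s Ω => (hw φ).exists_ae_eq hT
  refine ⟨fun t => ∀ φ ∈ D, ∫ x in Ω, slice u t x * φ x = k φ + ∫ σ in (-T)..t, u' σ φ,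
    (ae_ball_iff hDc).2 fun φ _ => hk φ, ?_⟩
  intro t ht τ hτ hPt hPτ φ
  have hu1 : IntegrableOn u' (timeI T) := hu'.integrable (by norm_num)
  have hii : ∀ a ∈ Icc (-T) 0, ∀ b ∈ Icc (-T) 0, IntervalIntegrable u' volume a b := by
    intro a ha b hb
    rw [intervalIntegrable_iff]
    refine hu1.mono_set ?_
    rw [uIoc]
    exact Ioc_subset_Ioc (le_min ha.1 hb.1) (max_le ha.2 hb.2)
  have h0 : -T ∈ Icc (-T) 0 := ⟨le_rfl, by linarith⟩
  have ht' := Ioc_subset_Icc_self ht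
  have hτ' := Ioc_subset_Icc_self hτ
  obtain ⟨L, hL⟩ := exists_dual_eq_setIntegral (s := s) hΩ (hu t ht').1
  obtain ⟨L', hL'⟩ := exists_dual_eq_setIntegral (s := s) hΩ (hu τ hτ').1
  have happ : ∀ a ∈ Icc (-T) 0, ∀ b ∈ Icc (-T) 0, ∀ φ : X0 n s Ω,
      (∫ σ in a..b, u' σ) φ = ∫ σ in a..b, u' σ φ := fun a ha b hb φ =>
    ContinuousLinearMap.intervalIntegral_apply (hii a ha b hb) φ
  have h1 : (fun φ => (L - L') φ) = fun φ => (∫ σ in τ..t, u' σ) φ := by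
    refine Continuous.ext_on hDd (L - L').continuous (ContinuousLinearMap.continuous _)
      fun φ hφ => ?_
    rw [sub_apply, hL, hL', hPt φ hφ, hPτ φ hφ,
      ← happ _ h0 _ ht', ← happ _ h0 _ hτ', add_sub_add_left_eq_sub,
      ← sub_apply,
      intervalIntegral.integral_interval_sub_left (hii _ h0 _ ht') (hii _ h0 _ hτ')]
  rw [← hL, ← hL', ← happ _ hτ' _ ht']
  exact congrFun h1 φ

/-- The tangent line inequality at a for the convex function r ↦ ½((r - M)⁺)², whose derivative is
(r - M)⁺. -/
theorem half_sq_max_sub_le (a b M : ℝ) :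
    max (a - M) 0 ^ 2 / 2 - max (b - M) 0 ^ 2 / 2 ≤ (a - b) * max (a - M) 0 := by
  rcases le_total (a - M) 0 with h1 | h1 <;> rcases le_total (b - M) 0 with h2 | h2 <;>
    simp only [max_eq_left, max_eq_right, h1, h2] <;> nlinarith [sq_nonneg (a - b)]

/-- Half the squared `L²` norm of the truncation `(v - M)⁺`. -/
def truncEnergy (M : ℝ) (v : Rn n → ℝ) : ℝ := ∫ x, max (v x - M) 0 ^ 2 / 2

theorem truncEnergy_nonneg (M : ℝ) (v : Rn n → ℝ) : 0 ≤ truncEnergy M v :=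
  integral_nonneg fun _ => by positivity

theorem integrable_truncEnergy (hM : 0 ≤ M) {v : Rn n → ℝ} (hv : MemLp v 2 volume) :
    Integrable (fun x => max (v x - M) 0 ^ 2 / 2) := by
  exact (memLp_posPart hv hM).integrable_sq.div_const 2

/-- Convexity of the truncated energy. -/
theorem truncEnergy_sub_le (hM : 0 ≤ M) {v w : Rn n → ℝ} (hv : MemLp v 2 volume)
    (hw : MemLp w 2 volume) {W : X0 n s Ω} (hW : W =ᵐ[volume] fun x => max (v x - M) 0) :
    truncEnergy M v - truncEnergy M w
      ≤ (∫ x in Ω, v x * W x) - ∫ x in Ω, w x * W x := by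
  have hWm : MemLp W 2 volume := Lp.memLp _
  have hv1 : Integrable (fun x => v x * W x) := hv.integrable_mul hWm
  have hw1 : Integrable (fun x => w x * W x) := hw.integrable_mul hWm
  have hz : ∀ f : Rn n → ℝ, ∫ x in Ω, f x * W x = ∫ x, f x * W x := fun f => by
    refine setIntegral_eq_integral_of_ae_compl_eq_zero ?_
    filter_upwards [W.ae_eq_zero] with x hx hxΩ
    rw [hx hxΩ, mul_zero]
  rw [hz, hz, truncEnergy, truncEnergy, ← integral_sub (integrable_truncEnergy hM hv)
    (integrable_truncEnergy hM hw), ← integral_sub hv1 hw1]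
  refine integral_mono_ae ((integrable_truncEnergy hM hv).sub (integrable_truncEnergy hM hw))
    (hv1.sub hw1) ?_
  filter_upwards [hW] with x hx
  simp only [hx, ← sub_mul]
  exact half_sq_max_sub_le _ _ _

theorem truncEnergy_eq {v : Rn n → ℝ} {W : X0 n s Ω}
    (hW : W =ᵐ[volume] fun x => max (v x - M) 0) :
    truncEnergy M v = ‖X0.toL2 W‖ ^ 2 / 2 := by
  have h := integral_norm_sq_eq_eLpNorm_sq (Lp.memLp (X0.toL2 W))
  rw [Lp.norm_def, ← h, truncEnergy, ← integral_div]
  refine integral_congr_ae ?_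
  filter_upwards [hW] with x hx
  rw [hx, Real.norm_eq_abs, sq_abs]

/-- The a priori bound of a truncation by the dual norm of the time derivative. -/
theorem norm_posPart_le (hK : IsKernel n s lam Lam K) (hs1 : s < 1) (hlam : 0 < lam)
    {v : Rn n → ℝ} (hv : MemHs s v) {W : X0 n s Ω}
    (hW : W =ᵐ[volume] fun x => max (v x - M) 0) {F : X0Dual n s Ω}
    (hF : kForm K v W + F W = 0) :
    F W ≤ 0 ∧ ‖W‖ ≤ ‖F‖ / ((1 - s) * lam) + 2 * ‖X0.toL2 W‖ := by
  have hc : 0 < (1 - s) * lam := mul_pos (by linarith) hlam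
  have h1 := le_kForm_posPart hK hs1 hlam hv hW
  have h2 : 0 ≤ (1 - s) * lam * ‖X0.diffQuotLp W‖ ^ 2 := by positivity
  refine ⟨by linarith, ?_⟩
  have h3 := (neg_le_abs (F W)).trans (F.le_opNorm W)
  rw [X0.norm_def] at h3 ⊢
  set D := ‖X0.diffQuotLp W‖
  set m := ‖X0.toL2 W‖
  have hm : 0 ≤ m := norm_nonneg _
  set q := ‖F‖ / ((1 - s) * lam) with hq
  have hq0 : 0 ≤ q := by positivity
  have hFq : ‖F‖ = q * ((1 - s) * lam) := (div_mul_cancel₀ _ hc.ne').symm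
  have h4 : D ^ 2 ≤ q * (m + D) := by
    refine le_of_mul_le_mul_left ?_ hc
    calc (1 - s) * lam * D ^ 2 ≤ ‖F‖ * (m + D) := by linarith
      _ = (1 - s) * lam * (q * (m + D)) := by rw [hFq]; ring
  -- If D > q + m, then D² > (q + m) D ≥ q D + q m, against `h4`.
  have h5 : D ≤ q + m := by
    by_contra h
    push Not at h
    nlinarith
  linarith

theorem norm_toL2_posPart_le {v : Rn n → ℝ} {W : X0 n s Ω}
    (hW : W =ᵐ[volume] fun x => max (v x - M) 0)
    {V : Lp ℝ 2 (volume : Measure (Rn n))} (hV : ∀ᵐ x, v x - M ≤ |V x|) :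
    ‖X0.toL2 W‖ ≤ ‖V‖ := by
  refine Lp.norm_le_norm_of_ae_le ?_
  filter_upwards [hW, hV] with x hx hx'
  rw [hx, Real.norm_eq_abs, Real.norm_eq_abs, abs_of_nonneg (le_max_right _ _)]
  exact max_le hx' (abs_nonneg _)

/-- The increment of the truncated energy of a solution. -/
theorem truncEnergy_slice_sub_le (hK : IsKernel n s lam Lam K) (hs1 : s < 1) (hlam : 0 < lam)
    (hM : 0 ≤ M) (hu : ∀ t ∈ Icc (-T) 0, MemHs s (slice u t))
    (hu' : MemLp u' 2 (volume.restrict (timeI T))) {t τ R : ℝ} (ht : t ∈ timeI T)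
    (hτ : τ ∈ timeI T) (hτt : τ ≤ t) (hext : ∀ᵐ x, x ∉ Ω → slice u t x ≤ M)
    {V : Lp ℝ 2 (volume : Measure (Rn n))} (hV : ∀ᵐ x, slice u t x - M ≤ |V x|) (hR : ‖V‖ ≤ R)
    (heq : ∀ φ : X0 n s Ω, kForm K (slice u t) φ + u' t φ = 0)
    (hsub : ∀ φ : X0 n s Ω, (∫ x in Ω, slice u t x * φ x) - (∫ x in Ω, slice u τ x * φ x)
      = ∫ σ in τ..t, u' σ φ) :
    truncEnergy M (slice u t) - truncEnergy M (slice u τ)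
      ≤ (‖u' t‖ / ((1 - s) * lam) + 2 * R) * ∫ σ in Ioc τ t, ‖u' σ - u' t‖ := by
  have hut := hu t (Ioc_subset_Icc_self ht)
  obtain ⟨W, hW⟩ := exists_X0_posPart hut hM hext
  obtain ⟨h1, h2⟩ := norm_posPart_le hK hs1 hlam hut hW (heq W)
  have h3 : ‖W‖ ≤ ‖u' t‖ / ((1 - s) * lam) + 2 * R := by
    linarith [norm_toL2_posPart_le hW hV]
  have hu1 : IntegrableOn u' (Ioc τ t) :=
    IntegrableOn.mono_set (hu'.integrable (by norm_num)) (Ioc_subset_Ioc hτ.1.le ht.2)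
  have hi : Integrable (fun σ => u' σ - u' t) (volume.restrict (Ioc τ t)) :=
    hu1.sub (integrable_const _)
  refine (truncEnergy_sub_le hM hut.1 (hu τ (Ioc_subset_Icc_self hτ)).1 hW).trans ?_
  rw [hsub W, intervalIntegral.integral_of_le hτt]
  -- Subtracting u'(t) is free: its pairing with W is nonpositive by `h1`.
  have h4 : ∀ σ, u' σ W ≤ ‖W‖ * ‖u' σ - u' t‖ := fun σ => by
    have h := (le_abs_self _).trans ((u' σ - u' t).le_opNorm W)
    rw [sub_apply] at h
    linarith [mul_comm ‖W‖ ‖u' σ - u' t‖]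
  calc ∫ σ in Ioc τ t, u' σ W ≤ ∫ σ in Ioc τ t, ‖W‖ * ‖u' σ - u' t‖ :=
        integral_mono (hu1.apply_continuousLinearMap W) (hi.norm.const_mul _) h4
    _ = ‖W‖ * ∫ σ in Ioc τ t, ‖u' σ - u' t‖ := integral_const_mul _ _
    _ ≤ _ := mul_le_mul_of_nonneg_right h3 (integral_nonneg fun _ => norm_nonneg _)

theorem aestronglyMeasurable_truncEnergy_slice (hum : AEMeasurable u (volRnI n T)) :
    AEStronglyMeasurable (fun t => truncEnergy M (slice u t)) (volume.restrict (timeI T)) := by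
  have h : AEMeasurable (fun z => max (u z - M) 0 ^ 2 / 2) (volRnI n T) :=
    (((hum.sub_const M).max aemeasurable_const).pow_const 2).div_const 2
  rw [volRnI_eq_prod] at h
  exact h.aestronglyMeasurable.prod_swap.integral_prod_right'

/-- The weak maximum principle: a solution with lateral and initial values at most `M` is at
most `M`. -/
theorem ae_le_of_kForm_add_eq_zero (hT : 0 < T) (hK : IsKernel n s lam Lam K) (hs1 : s < 1)
    (hlam : 0 < lam) (hΩ : MeasurableSet Ω) (hM : 0 ≤ M) (hum : AEMeasurable u (volRnI n T))
    (hu : ∀ t ∈ Icc (-T) 0, MemHs s (slice u t))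
    (hext : ∀ᵐ t ∂(volume.restrict (timeI T)), ∀ᵐ x, x ∉ Ω → slice u t x ≤ M)
    {V : ℝ → Lp ℝ 2 (volume : Measure (Rn n))} (hVc : ContinuousOn V (Icc (-T) 0))
    (hV0 : V (-T) = 0)
    (huV : ∀ᵐ t ∂(volume.restrict (timeI T)), ∀ᵐ x, slice u t x - M ≤ |V t x|)
    (hu' : MemLp u' 2 (volume.restrict (timeI T))) (hw : HasWeakTimeDeriv T u u')
    (heq : ∀ φ : X0 n s Ω, ∀ᵐ t ∂(volume.restrict (timeI T)),
      kForm K (slice u t) φ + u' t φ = 0) :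
    ∀ᵐ z ∂(volRnI n T), u z ≤ M := by
  have hc : 0 < (1 - s) * lam := mul_pos (by linarith) hlam
  obtain ⟨R, hR⟩ := isCompact_Icc.exists_bound_of_continuousOn hVc
  have hR0 : 0 ≤ R := (norm_nonneg _).trans (hR 0 ⟨by linarith, le_rfl⟩)
  obtain ⟨P, hP, hsub⟩ := exists_ae_setIntegral_sub_eq hT hΩ hu hu' hw
  let Good : ℝ → Prop := fun t => P t ∧ (∀ᵐ x, x ∉ Ω → slice u t x ≤ M) ∧
    (∀ᵐ x, slice u t x - M ≤ |V t x|) ∧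
    ∀ φ : X0 n s Ω, kForm K (slice u t) φ + u' t φ = 0
  have hgood : ∀ᵐ t ∂(volume.restrict (timeI T)), Good t := by
    filter_upwards [hP, hext, huV, ae_forall_kForm_add_eq_zero hK hs1 hlam hu heq]
      with t h1 h2 h3 h4
    exact ⟨h1, h2, h3, h4⟩
  let e : ℝ → ℝ := fun t => truncEnergy M (slice u t)
  -- Domination by V gives both integrability of the energy and, with V(-T) = 0, its zero initial
  -- value.
  have heV : ∀ t ∈ timeI T, Good t → e t ≤ ‖V t‖ ^ 2 / 2 := by
    intro t ht hg
    obtain ⟨W, hW⟩ := exists_X0_posPart (hu t (Ioc_subset_Icc_self ht)) hM hg.2.1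
    show truncEnergy M (slice u t) ≤ _
    rw [truncEnergy_eq hW]
    have := norm_toL2_posPart_le hW hg.2.2.1
    gcongr
  have hei : IntegrableOn e (timeI T) := by
    refine Integrable.mono' (g := fun _ => R ^ 2 / 2) (integrable_const _)
      (aestronglyMeasurable_truncEnergy_slice hum) ?_
    filter_upwards [hgood, ae_restrict_mem measurableSet_Ioc] with t hg ht
    rw [Real.norm_of_nonneg (truncEnergy_nonneg _ _)]
    refine (heV t ht hg).trans ?_
    have := hR t (Ioc_subset_Icc_self ht)
    gcongr
  have hb : MemLp (fun t => ‖u' t‖ / ((1 - s) * lam) + 2 * R) 2 (volume.restrict (timeI T)) := by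
    refine ((hu'.norm.const_mul ((1 - s) * lam)⁻¹).add (memLp_const (2 * R))).ae_eq
      (Eventually.of_forall fun t => ?_)
    show ((1 - s) * lam)⁻¹ * ‖u' t‖ + 2 * R = ‖u' t‖ / ((1 - s) * lam) + 2 * R
    rw [div_eq_inv_mul]
  have hstart : ∀ ε, 0 < ε → ∃ r > -T, ∀ τ ∈ Ioc (-T) r, τ ∈ timeI T → Good τ → e τ ≤ ε := by
    intro ε hε
    have hlim : Tendsto (fun τ => ‖V τ‖ ^ 2 / 2) (𝓝[Icc (-T) 0] (-T)) (𝓝 0) := by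
      have h2 := ((hVc (-T) ⟨le_rfl, by linarith⟩).tendsto.norm.pow 2).div_const 2
      rw [hV0] at h2
      simpa using h2
    have hlim' := hlim.mono_left (nhdsWithin_mono _ (Ioc_subset_Icc_self (a := -T) (b := 0)))
    rw [nhdsWithin_Ioc_eq_nhdsGT (by linarith)] at hlim'
    obtain ⟨r, hr, hr'⟩ := mem_nhdsGT_iff_exists_Ioc_subset.1 (hlim'.eventually_le_const hε)
    exact ⟨r, hr, fun τ hτ hτI hg => (heV τ hτI hg).trans (hr' hτ)⟩
  have hzero := ae_eq_zero_of_sub_le_of_ae (a := -T) (b := 0)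
    (fun t => truncEnergy_nonneg M (slice u t)) hei (fun t => by positivity) hb hu' hgood hstart
    (fun t ht hgt τ hτ hgτ hτt => truncEnergy_slice_sub_le hK hs1 hlam hM hu hu' ht hτ hτt
      hgt.2.1 hgt.2.2.1 (hR t (Ioc_subset_Icc_self ht)) hgt.2.2.2
      (hsub t ht τ hτ hgt.1 hgτ.1))
  refine ae_le_of_ae_ae_slice hum ?_
  filter_upwards [hzero, hgood, ae_restrict_mem measurableSet_Ioc] with t h1 hg ht
  obtain ⟨W, hW⟩ := exists_X0_posPart (hu t (Ioc_subset_Icc_self ht)) hM hg.2.1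
  have h2 : ‖X0.toL2 W‖ ^ 2 / 2 = 0 := (truncEnergy_eq hW).symm.trans h1
  have h3 : X0.toL2 W = 0 := by
    rw [← norm_eq_zero, ← sq_eq_zero_iff]
    linarith
  filter_upwards [hW, (Lp.eq_zero_iff_ae_eq_zero).1 h3] with x hx hx0
  rw [hx0] at hx
  have := le_max_left (slice u t x - M) 0
  rw [← hx] at this
  simpa using this

theorem MemHs.neg {v : Rn n → ℝ} (hv : MemHs s v) : MemHs s (-v) := by
  refine ⟨hv.1.neg, ?_⟩
  have h : diffQuot s (-v) = (-1 : ℝ) • diffQuot s v := by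
    rw [← diffQuot_smul, neg_one_smul]
  rw [h]
  exact hv.2.const_smul _

theorem HasWeakDeriv.neg {a b : ℝ → ℝ} (h : HasWeakDeriv T a b) :
    HasWeakDeriv T (fun t => -a t) (fun t => -b t) := by
  refine ⟨h.1.neg, h.2.1.neg, fun ψ h1 h2 h3 => ?_⟩
  simp only [mul_neg, integral_neg]
  rw [h.2.2 ψ h1 h2 h3]

theorem kForm_neg_left (v w : Rn n → ℝ) : kForm K (-v) w = -kForm K v w := by
  rw [kForm, kForm, ← integral_neg]
  refine integral_congr_ae (Eventually.of_forall fun p => ?_)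
  simp only [Pi.neg_apply]
  ring

/-- A weak solution with bounded data is bounded by the data. -/
theorem IsWeakSolution.ae_abs_le {g : Rn n × ℝ → ℝ} (hT : 0 < T)
    (hK : IsKernel n s lam Lam K) (hs1 : s < 1) (hlam : 0 < lam) (hΩ : MeasurableSet Ω)
    (hM : 0 ≤ M) (hg : ∀ᵐ z ∂(volRnI n T), |g z| ≤ M)
    (hu : IsWeakSolution (s := s) (Ω := Ω) T K 0 g (slice g (-T)) u) :
    ∀ᵐ z ∂(volRnI n T), |u z| ≤ M := by
  obtain ⟨⟨⟨hum, huH⟩, ⟨X, -, hX⟩, -⟩, ⟨u', hu', hw, heq⟩, h0, V, hVc, hV, hVT⟩ := hu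
  have hV0 : V (-T) = 0 := by
    rw [Lp.eq_zero_iff_ae_eq_zero]
    filter_upwards [hVT, h0] with x h1 h2
    rw [h1]
    simp only [slice, Pi.sub_apply, Pi.zero_apply] at h2 ⊢
    linarith
  have hgs := ae_ae_slice_of_ae hg
  have hext : ∀ᵐ t ∂(volume.restrict (timeI T)), ∀ᵐ x, x ∉ Ω → |slice u t x| ≤ M := by
    filter_upwards [hgs, hX] with t h1 h2
    filter_upwards [h1, h2, (X t).ae_eq_zero] with x k1 k2 k3 hx
    rw [k3 hx] at k2
    simp only [slice, Pi.sub_apply] at k2 ⊢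
    rwa [show u (x, t) = g (x, t) by linarith]
  -- Since |g| ≤ M, the excess of |u| over M is at most |u - g|, and V(t) represents u - g. With
  -- absolute values, the same V serves for u and -u.
  have huV : ∀ᵐ t ∂(volume.restrict (timeI T)), ∀ᵐ x, |slice u t x| - M ≤ |V t x| := by
    filter_upwards [hgs, hV] with t h1 h2
    filter_upwards [h1, h2] with x k1 k2
    rw [k2]
    simp only [slice, Pi.sub_apply]
    linarith [abs_sub_abs_le_abs_sub (u (x, t)) (g (x, t))]
  have hup := ae_le_of_kForm_add_eq_zero hT hK hs1 hlam hΩ hM hum huH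
    (hext.mono fun t h => h.mono fun x h hx => (le_abs_self _).trans (h hx)) hVc hV0
    (huV.mono fun t h => h.mono fun x h => (sub_le_sub_right (le_abs_self _) _).trans h)
    hu' hw (fun φ => (heq φ).mono fun t h => by simpa using h)
  have hdown := ae_le_of_kForm_add_eq_zero (u := -u) (u' := -u') hT hK hs1 hlam hΩ hM hum.neg
    (fun t ht => (huH t ht).neg)
    (hext.mono fun t h => h.mono fun x h hx => (neg_le_abs _).trans (h hx)) hVc hV0
    (huV.mono fun t h => h.mono fun x h => (sub_le_sub_right (neg_le_abs _) _).trans h)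
    hu'.neg
    (fun φ => by
      have h := (hw φ).neg
      simp only [← integral_neg, ← neg_mul] at h
      exact h)
    (fun φ => (heq φ).mono fun t h => by
      have h1 : kForm K (slice (-u) t) φ = -kForm K (slice u t) φ := kForm_neg_left _ _
      rw [h1]
      simp only [Pi.zero_apply, sub_zero, Pi.neg_apply, neg_apply] at h ⊢
      linarith)
  filter_upwards [hup, hdown] with z h1 h2
  exact abs_le.2 ⟨by simp only [Pi.neg_apply] at h2; linarith, h1⟩

end

end NonlocalHeat

end

theorem theorem4p1 (n : ℕ) (hn : 1 ≤ n) (s lam Lam T : ℝ) (hs0 : 0 < s) (hs1 : s < 1)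
    (hlam : 0 < lam) (hT : 0 < T)
    (K : NonlocalHeat.Rn n → ℝ) (hK : NonlocalHeat.IsKernel n s lam Lam K)
    (Ω : Set (NonlocalHeat.Rn n)) (hΩo : IsOpen Ω) (hΩb : Bornology.IsBounded Ω)
    (g : NonlocalHeat.Rn n × ℝ → ℝ) (hg : NonlocalHeat.MemHsT s T g)
    (hgc : ContinuousOn g (Set.univ ×ˢ Set.Icc (-T) 0))
    (hgb : MeasureTheory.MemLp g ⊤ (NonlocalHeat.volRnI n T))
    (u : NonlocalHeat.Rn n × ℝ → ℝ)
    (hu : NonlocalHeat.IsWeakSolution (s := s) (Ω := Ω) T K 0 g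
      (NonlocalHeat.slice g (-T)) u) :
    MeasureTheory.MemLp u ⊤ (NonlocalHeat.volRnI n T) ∧
      MeasureTheory.eLpNorm u ⊤ (NonlocalHeat.volRnI n T) ≤
        2 * MeasureTheory.eLpNorm g ⊤ (NonlocalHeat.volRnI n T) := by
  have hgM : ∀ᵐ z ∂(NonlocalHeat.volRnI n T),
      |g z| ≤ (eLpNorm g ⊤ (NonlocalHeat.volRnI n T)).toReal := by
    filter_upwards [ae_le_eLpNormEssSup (f := g) (μ := NonlocalHeat.volRnI n T)] with z hz
    rw [← eLpNorm_exponent_top] at hz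
    simpa using ENNReal.toReal_mono hgb.eLpNorm_ne_top hz
  have huM := hu.ae_abs_le hT hK hs1 hlam hΩo.measurableSet ENNReal.toReal_nonneg hgM
  refine ⟨memLp_top_of_bound hu.mem.1.1.aestronglyMeasurable _ huM, ?_⟩
  calc eLpNorm u ⊤ (NonlocalHeat.volRnI n T)
      ≤ ENNReal.ofReal (eLpNorm g ⊤ (NonlocalHeat.volRnI n T)).toReal := by
        rw [eLpNorm_exponent_top]
        exact eLpNormEssSup_le_of_ae_bound huM
    _ = eLpNorm g ⊤ (NonlocalHeat.volRnI n T) := ENNReal.ofReal_toReal hgb.eLpNorm_ne_top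
    -- The factor 2 is slack: the bound already holds with constant 1.
    _ ≤ 2 * eLpNorm g ⊤ (NonlocalHeat.volRnI n T) := le_mul_of_one_le_left' one_le_two
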